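/- Let $X$ be a separable real Hilbert space and $TX:=X\times X$ with coordinate maps $\mathsf x(x,v)=x$, $\mathsf v(x,v)=v$. Let $\mathcal P_2(X)$ and $\mathcal P_2(TX)$ be the Borel probability measures with finite second moment on $X$ and $TX$; $\Gamma(\mu,\nu)$ is the set of couplings of $\mu$ and $\nu$, $W_2$ is the $L^2$-Wasserstein distance, and $\Gamma_o(\mu_0,\mu_1)$ is the set of couplings that are optimal for $W_2$. The space $\mathcal P_2^{sw}(TX)$ is $\mathcal P_2(TX)$ with the coarsest topology making $\Phi\mapsto\int\zeta\,d\Phi$ continuous for every $\zeta:TX\to\mathbb R$ that is sequentially continuous for the strong topology in $x$ and the weak topology in $v$ and satisfies: for every $\varepsilon>0$ there is $A_\varepsilon\ge0$ with $|\zeta(x,v)|\le A_\varepsilon(1+|x|^2)+\varepsilon|v|^2$. For a set $\mathbf F\subset\mathcal P_2(TX)$ put $D(\mathbf F):=\{\mathsf x_\sharp\Phi:\Phi\in\mathbf F\}$ and $\mathbf F[\mu]:=\{\Phi\in\mathbf F:\mathsf x_\sharp\Phi=\mu\}$. A nonempty $\mathbf F$ is a probability vector field (PVF) if $\mathbf F[\mu]$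 is a singleton for each $\mu\in D(\mathbf F)$; in that case $\mathbf F[\mu]$ also denotes its element. It is deterministic if every $\Phi\in\mathbf F$ is concentrated on the graph of its barycenter, i.e. $\Phi=(\mathrm{id},b_\Phi)_\sharp(\mathsf x_\sharp\Phi)$ where $b_\Phi(x)=\int v\,d\Phi_x(v)$ and $(\Phi_x)$ is the disintegration of $\Phi$ with respect to $\mathsf x_\sharp\Phi$. It is demicontinuous if $W_2(\mu_n,\mu)\to0$ (with $\mu_n,\mu\in D(\mathbf F)$) implies $\mathbf F[\mu_n]\to\mathbf F[\mu]$ in $\mathcal P_2^{sw}(TX)$. For $\lambda\in\mathbb R$, $\mathbf F$ is (metrically) $\lambda$-dissipative if for all $\Phi_0,\Phi_1\in\mathbf F$ $$\min_{\Theta}\int\langle x_0-x_1,v_0-v_1\rangle\,d\Theta(x_0,v_0,x_1,v_1)\le\lambda\,W_2^2(\mathsf x_\sharp\Phi_0,\mathsf x_\sharp\Phi_1),$$ the minimum being over those $\Theta\in\Gamma(\Phi_0,\Phi_1)$ whose $(x_0,x_1)$-marginal belongs to $\Gamma_o(\mathsf x_\sharp\Phi_0,\mathsf x_\sharp\Phi_1)$.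 It is totally $\lambda$-dissipative if for all $\Phi_0,\Phi_1\in\mathbf F$ and every $\Theta\in\Gamma(\Phi_0,\Phi_1)$ $$\int\langle v_1-v_0,x_1-x_0\rangle\,d\Theta\le\lambda\int|x_1-x_0|^2\,d\Theta,$$ and maximal totally $\lambda$-dissipative if in addition no strictly larger subset of $\mathcal P_2(TX)$ is totally $\lambda$-dissipative. **Theorem.** Let $\lambda\in\mathbb R$ and let $\mathbf F\subset\mathcal P_2(TX)$ be a deterministic, demicontinuous, $\lambda$-dissipative PVF with $D(\mathbf F)=\mathcal P_2(X)$, of the form $$\mathbf F[\mu]=(\mathrm{id},\mathbf f(\cdot,\mu))_\sharp\mu,\qquad \mu\in\mathcal P_2(X),$$ for a map $\mathbf f:\mathcal S(X)\to X$, where $\mathcal S(X):=\{(x,\mu)\in X\times\mathcal P_2(X):x\in\operatorname{supp}\mu\}$. Then $\mathbf F$ is maximal totally $\lambda$-dissipative. If moreover there exists $L>0$ such that for every $\mu_0,\mu_1\in\mathcal P_2(X)$ there is $\gamma\in\Gamma_o(\mu_0,\mu_1)$ satisfying $$\int_{X\times X}|\mathbf f(x_1,\mu_1)-\mathbf f(x_0,\mu_0)|^2\,d\gamma(x_0,x_1)\le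 L^2\int_{X\times X}|x_1-x_0|^2\,d\gamma(x_0,x_1),\qquad(*)$$ then $(*)$ holds, with the same $L$, for every $\mu_0,\mu_1\in\mathcal P_2(X)$ and every $\gamma\in\Gamma(\mu_0,\mu_1)$. -/

import Mathlib

open MeasureTheory Filter Topology
open scoped ENNReal RealInnerProductSpace

noncomputable section

namespace PVF

/-! ### Measures with finite second moment and couplings -/

section P2

/-- `𝒫₂(E)`: the Borel probability measures on `E` with finite second moment.
For `E = X × X` the sup norm of the product gives the same finiteness condition as
the norm `(|x|² + |v|²)^{1/2}`. -/
@[ext]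
structure P2 (E : Type*) [NormedAddCommGroup E] [MeasurableSpace E] where
  toMeasure : Measure E
  isProb : IsProbabilityMeasure toMeasure
  moment : ∫⁻ x, ‖x‖ₑ ^ 2 ∂toMeasure < ∞

instance {E : Type*} [NormedAddCommGroup E] [MeasurableSpace E] (μ : P2 E) :
    IsProbabilityMeasure μ.toMeasure := μ.isProb

/-- `Γ(μ, ν)`: the measures on the product with marginals `μ` and `ν`
(automatically probability measures when `μ` and `ν` are). -/
def couplings {α β : Type*} [MeasurableSpace α] [MeasurableSpace β]
    (μ : Measure α) (ν : Measure β) : Set (Measure (α × β)) :=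
  {γ | γ.map Prod.fst = μ ∧ γ.map Prod.snd = ν}

variable {X : Type*} [NormedAddCommGroup X] [MeasurableSpace X]

/-- The `L²`-Wasserstein distance on `𝒫₂(X)`. -/
def W2 (μ ν : P2 X) : ℝ :=
  √(sInf ((fun γ : Measure (X × X) => ∫ p, ‖p.1 - p.2‖ ^ 2 ∂γ) ''
    couplings μ.toMeasure ν.toMeasure))

/-- `Γₒ(μ, ν)`: the optimal couplings. -/
def optimalCouplings (μ ν : P2 X) : Set (Measure (X × X)) :=
  {γ | γ ∈ couplings μ.toMeasure ν.toMeasure ∧ ∫ p, ‖p.1 - p.2‖ ^ 2 ∂γ = W2 μ ν ^ 2}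

/-- The first marginal `x_♯ Φ ∈ 𝒫₂(X)` of `Φ ∈ 𝒫₂(TX)`, where `TX = X × X`. -/
def P2.base [BorelSpace X] (Φ : P2 (X × X)) : P2 X where
  toMeasure := Φ.toMeasure.map Prod.fst
  isProb := Measure.isProbabilityMeasure_map measurable_fst.aemeasurable
  moment := by
    rw [lintegral_map (by fun_prop) measurable_fst]
    refine lt_of_le_of_lt (lintegral_mono fun p => ?_) Φ.moment
    have h : ‖p.1‖ₑ ≤ ‖p‖ₑ := by
      simp only [enorm_le_iff_norm_le]
      exact norm_fst_le p
    gcongr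

end P2

/-! ### Probability vector fields -/

section Fields

variable {X : Type*} [NormedAddCommGroup X] [InnerProductSpace ℝ X]
  [MeasurableSpace X] [BorelSpace X]

/-- The domain `D(F) = x_♯ F` of a multivalued probability vector field `F ⊆ 𝒫₂(TX)`. -/
def domain (F : Set (P2 (X × X))) : Set (P2 X) := P2.base '' F

/-- The section `F[μ] = {Φ ∈ F | x_♯ Φ = μ}`. -/
def fiber (F : Set (P2 (X × X))) (μ : P2 X) : Set (P2 (X × X)) := {Φ ∈ F | Φ.base = μ}

/-- A (single-valued) probability vector field: a nonempty set on which `x_♯` is injective. -/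
def IsPVF (F : Set (P2 (X × X))) : Prop := F.Nonempty ∧ Set.InjOn P2.base F

/-- The barycenter `x ↦ ∫ v dΦ_x(v)`, where `(Φ_x)` is the disintegration of `Φ` with respect to
its first marginal. -/
def barycenter [CompleteSpace X] [SecondCountableTopology X] (Φ : P2 (X × X)) : X → X :=
  fun x => ∫ v, v ∂(Φ.toMeasure.condKernel x)

/-- Every `Φ ∈ F` is concentrated on (the graph of) its barycenter. -/
def IsDeterministic [CompleteSpace X] [SecondCountableTopology X]
    (F : Set (P2 (X × X))) : Prop :=
  ∀ Φ ∈ F, Φ.toMeasure = Φ.base.toMeasure.map (fun x => (x, barycenter Φ x))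

/-- Test functions for the strong-weak topology: sequentially continuous on `X^s × X^w`, and
for every `ε > 0` bounded by `A (1 + |x|²) + ε |v|²` for some `A ≥ 0`. -/
def IsTestSW (ζ : X × X → ℝ) : Prop :=
  SeqContinuous (fun p : X × WeakSpace ℝ X => ζ (p.1, (toWeakSpace ℝ X).symm p.2)) ∧
  ∀ ε > 0, ∃ A ≥ 0, ∀ x v : X, |ζ (x, v)| ≤ A * (1 + ‖x‖ ^ 2) + ε * ‖v‖ ^ 2

/-- The topology of `𝒫₂^{sw}(TX)`: the coarsest one making `Φ ↦ ∫ ζ dΦ` continuous for every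
test function `ζ`. -/
abbrev swTopology (X : Type*) [NormedAddCommGroup X] [InnerProductSpace ℝ X]
    [MeasurableSpace X] : TopologicalSpace (P2 (X × X)) :=
  ⨅ ζ : {ζ : X × X → ℝ // IsTestSW ζ},
    TopologicalSpace.induced (fun Φ : P2 (X × X) => ∫ p, ζ.1 p ∂Φ.toMeasure) inferInstance

/-- Demicontinuity of a single-valued field: `μₙ → μ` in `(𝒫₂(X), W₂)`, with `μₙ, μ ∈ D(F)`,
implies `F[μₙ] → F[μ]` in `𝒫₂^{sw}(TX)`. Here `Φₙ = F[μₙ]` and `Φ = F[μ]`. -/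
def IsDemicontinuous (F : Set (P2 (X × X))) : Prop :=
  ∀ (Φn : ℕ → P2 (X × X)) (Φ : P2 (X × X)), (∀ n, Φn n ∈ F) → Φ ∈ F →
    Tendsto (fun n => W2 (Φn n).base Φ.base) atTop (𝓝 0) →
    Tendsto Φn atTop (@nhds _ (swTopology X) Φ)

/-- `Λ(Φ₀, Φ₁)`: couplings `Θ` of `Φ₀, Φ₁`, on points `((x₀, v₀), (x₁, v₁))`, such that
`(x₀, x₁)_♯ Θ` is an optimal coupling of the first marginals. -/
def optimalLifts (Φ₀ Φ₁ : P2 (X × X)) : Set (Measure ((X × X) × (X × X))) :=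
  {Θ | Θ ∈ couplings Φ₀.toMeasure Φ₁.toMeasure ∧
    Θ.map (fun q => (q.1.1, q.2.1)) ∈ optimalCouplings Φ₀.base Φ₁.base}

/-- The pairing `[Φ₀, Φ₁]_r`: the least value of `∫ ⟨x₀ - x₁, v₀ - v₁⟩ dΘ` over
`Θ ∈ Λ(Φ₀, Φ₁)`. -/
def pairing (Φ₀ Φ₁ : P2 (X × X)) : ℝ :=
  sInf ((fun Θ : Measure ((X × X) × (X × X)) => ∫ q, ⟪q.1.1 - q.2.1, q.1.2 - q.2.2⟫ ∂Θ) ''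
    optimalLifts Φ₀ Φ₁)

/-- Metric `lam`-dissipativity. -/
def IsDissipative (lam : ℝ) (F : Set (P2 (X × X))) : Prop :=
  ∀ Φ₀ ∈ F, ∀ Φ₁ ∈ F, pairing Φ₀ Φ₁ ≤ lam * W2 Φ₀.base Φ₁.base ^ 2

/-- Total `lam`-dissipativity. -/
def IsTotallyDissipative (lam : ℝ) (F : Set (P2 (X × X))) : Prop :=
  ∀ Φ₀ ∈ F, ∀ Φ₁ ∈ F, ∀ Θ ∈ couplings Φ₀.toMeasure Φ₁.toMeasure,
    ∫ q, ⟪q.2.2 - q.1.2, q.2.1 - q.1.1⟫ ∂Θ ≤ lam * ∫ q, ‖q.2.1 - q.1.1‖ ^ 2 ∂Θ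

/-- `F` is totally `lam`-dissipative and has no proper totally `lam`-dissipative extension. -/
def IsMaximalTotallyDissipative (lam : ℝ) (F : Set (P2 (X × X))) : Prop :=
  IsTotallyDissipative lam F ∧
    ∀ F' : Set (P2 (X × X)), F ⊆ F' → IsTotallyDissipative lam F' → F' = F

end Fields

/-! ### Maps defined on points of the support -/

section Maps

variable {X : Type*} [NormedAddCommGroup X] [MeasurableSpace X]

/-- `𝒮(X) = {(x, μ) ∈ X × 𝒫₂(X) | x ∈ supp μ}`. -/
def SuppPairs (X : Type*) [NormedAddCommGroup X] [MeasurableSpace X] : Type _ :=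
  {p : X × P2 X // p.1 ∈ p.2.toMeasure.support}

open Classical in
/-- The function `f(·, μ)`, extended by `0` outside `supp μ` (a `μ`-null set in a separable
space). -/
def atMeasure (f : SuppPairs X → X) (μ : P2 X) : X → X :=
  fun x => if h : x ∈ μ.toMeasure.support then f ⟨(x, μ), h⟩ else 0

/-- The bound `∫ |f(x₁, μ₁) - f(x₀, μ₀)|² dγ ≤ L² ∫ |x₁ - x₀|² dγ` along `γ`. -/
def LipschitzAlong (f : SuppPairs X → X) (L : ℝ) (μ₀ μ₁ : P2 X)
    (γ : Measure (X × X)) : Prop :=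
  ∫ p, ‖atMeasure f μ₁ p.2 - atMeasure f μ₀ p.1‖ ^ 2 ∂γ ≤ L ^ 2 * ∫ p, ‖p.2 - p.1‖ ^ 2 ∂γ

end Maps

end PVF

end

/-!
The field acts on square integrable random variables by `B Z = b(Z, law Z)`, where
`b(·, μ)` is a measurable version of `f(·, μ)` (`VelocityField.act`). Couplings of two elements of
the field are joint laws of `(Z₀, B Z₀)` and `(Z₁, B Z₁)`, so total `lam`-dissipativity says that
`B - lam` is dissipative on every `L²(Ω; X)`, and the Lipschitz bound along all couplings says that
`B` is `L`-Lipschitz there.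

Two facts carry the proof. First, demicontinuity together with the graph form of the field makes
`B` continuous from the strong to the weak topology of `L²`
(`VelocityField.tendsto_inner_act`). Convergence in `𝒫₂^{sw}` bounds the second moments of the
velocities (`exists_integral_norm_snd_sq_le`), and the limit is a graph, so testing with
`|⟪c, v⟫ - g(x)|`, for bounded continuous `g` close to `⟪c, b(x, μ)⟫` in `L¹(μ)`, identifies the
weak limit.

Second, along a line `Zₜ = Z + t D` of simple random variables, moving atoms collide at finitely
many times only. Near any other time each atom remains the strictly nearest one to its own
previous position, so the joint law of `Zₛ` and `Zₜ` is the only optimal coupling of their laws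
(`exists_finite_eventually_isUniquelyMatched`). Hence the conditions imposed along optimal couplings
hold between `Zₛ` and `Zₜ`: they say that scalar functions such as `⟪D, B Zₜ⟫ - lam t ‖D‖²` are
locally nonincreasing off a finite set, and weak continuity of `B` extends this to all times
(`VelocityField.inner_act_sub_le_of_locally`). Density of simple random variables and weak
continuity then give the estimates on all of `L²`. No restriction on the dimension of `X` enters,
because demicontinuity excludes jumps at collisions.

Maximality is Minty's argument (`VelocityField.eq_range_graph_of_isTotallyDissipative`).
-/

namespace PVF

/-! ### Monotonicity from local monotonicity -/

section Scalar

/-- A continuous function that does not increase immediately to the right of any point of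
`[a, b)` does not increase from `a` to `b`. -/
lemma le_of_continuous_of_eventually_right {h : ℝ → ℝ} (hc : Continuous h) {a b : ℝ}
    (hab : a ≤ b) (H : ∀ x ∈ Set.Ico a b, ∀ᶠ y in 𝓝[>] x, h y ≤ h x) : h b ≤ h a := by
  have key : Set.Icc a b ⊆ {x | h x ≤ h a} := by
    refine IsClosed.Icc_subset_of_forall_mem_nhdsWithin ?_ (le_refl (h a)) ?_
    · exact (isClosed_le hc continuous_const).inter isClosed_Icc
    · rintro x ⟨hx, hxI⟩
      filter_upwards [H x hxI] with y hy using hy.trans hx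
  exact key ⟨hab, le_refl b⟩

/-- Local antitonicity away from finitely many points, plus continuity, gives antitonicity. -/
lemma antitone_of_continuous_of_locally_antitone {h : ℝ → ℝ} (hc : Continuous h) {S : Set ℝ}
    (hS : S.Finite)
    (H : ∀ x ∉ S, ∀ᶠ p : ℝ × ℝ in 𝓝 (x, x), p.1 ≤ p.2 → h p.2 ≤ h p.1) : Antitone h := by
  have right : ∀ x ∉ S, ∀ᶠ y in 𝓝[>] x, h y ≤ h x := by
    intro x hx
    have h1 : Tendsto (fun y : ℝ => (x, y)) (𝓝[>] x) (𝓝 (x, x)) :=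
      (Continuous.tendsto (by fun_prop) x).mono_left nhdsWithin_le_nhds
    filter_upwards [h1.eventually (H x hx), self_mem_nhdsWithin] with y hy hxy
    exact hy (le_of_lt hxy)
  -- by continuity the end points of an interval may belong to `S`
  have gap : ∀ a b : ℝ, a < b → (∀ x ∈ Set.Ioo a b, x ∉ S) → h b ≤ h a := by
    intro a b hab hI
    refine ge_of_tendsto ((hc.tendsto a).mono_left (nhdsWithin_le_nhds (s := Set.Ioi a))) ?_
    filter_upwards [Ioo_mem_nhdsGT hab] with a' ha'
    exact le_of_continuous_of_eventually_right hc ha'.2.le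
      fun x hx => right x (hI x ⟨ha'.1.trans_le hx.1, hx.2⟩)
  intro a b hab
  refine le_of_continuous_of_eventually_right hc hab fun x _ => ?_
  have hcl : (S \ {x})ᶜ ∈ 𝓝 x :=
    (hS.subset Set.sdiff_subset).isClosed.isOpen_compl.mem_nhds (by simp)
  obtain ⟨u, hu, hsub⟩ := exists_Ico_subset_of_mem_nhds hcl ⟨x + 1, by linarith⟩
  filter_upwards [Ioo_mem_nhdsGT hu] with y hy
  refine gap x y hy.1 fun z hz hzS => ?_
  exact hsub ⟨hz.1.le, hz.2.trans hy.2⟩ ⟨hzS, by simpa using hz.1.ne'⟩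

end Scalar

/-! ### Test functions of the strong-weak topology -/

section TestFunctions

variable {X : Type*} [NormedAddCommGroup X] [InnerProductSpace ℝ X]

lemma tendsto_inner_of_tendsto_weakSpace {v : ℕ → WeakSpace ℝ X} {v₀ : WeakSpace ℝ X}
    (h : Tendsto v atTop (𝓝 v₀)) (w : X) :
    Tendsto (fun n => ⟪w, (toWeakSpace ℝ X).symm (v n)⟫) atTop
      (𝓝 ⟪w, (toWeakSpace ℝ X).symm v₀⟫) :=
  ((WeakBilin.eval_continuous (topDualPairing ℝ X).flip (innerSL ℝ w)).tendsto v₀).comp h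

/-- Weakly convergent sequences are bounded, by the uniform boundedness principle. -/
lemma exists_norm_le_of_tendsto_weakSpace [CompleteSpace X] {v : ℕ → WeakSpace ℝ X}
    {v₀ : WeakSpace ℝ X} (h : Tendsto v atTop (𝓝 v₀)) :
    ∃ C, ∀ n, ‖(toWeakSpace ℝ X).symm (v n)‖ ≤ C := by
  obtain ⟨C, hC⟩ := banach_steinhaus (g := fun n => innerSL ℝ ((toWeakSpace ℝ X).symm (v n))) (by
    intro w
    obtain ⟨C, hC⟩ := (tendsto_inner_of_tendsto_weakSpace h w).norm.bddAbove_range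
    refine ⟨C, fun n => ?_⟩
    rw [innerSL_apply_apply, real_inner_comm]
    exact hC ⟨n, rfl⟩)
  exact ⟨C, fun n => by simpa using hC n⟩

lemma IsTestSW.continuous {ζ : X × X → ℝ} (hζ : IsTestSW ζ) : Continuous ζ := by
  have h : SeqContinuous ζ := by
    intro p p₀ hp
    refine hζ.1 (x := fun n => ((p n).1, toWeakSpace ℝ X (p n).2))
      (p := (p₀.1, toWeakSpace ℝ X p₀.2)) ?_
    rw [nhds_prod_eq] at hp ⊢
    exact (tendsto_fst.comp hp).prodMk
      (((toWeakSpaceCLM ℝ X).continuous.tendsto p₀.2).comp (tendsto_snd.comp hp))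
  exact h.continuous

lemma IsTestSW.tendsto_integral [MeasurableSpace X] {ζ : X × X → ℝ} (hζ : IsTestSW ζ)
    {Φn : ℕ → P2 (X × X)} {Φ : P2 (X × X)} (h : Tendsto Φn atTop (@nhds _ (swTopology X) Φ)) :
    Tendsto (fun n => ∫ p, ζ p ∂(Φn n).toMeasure) atTop (𝓝 (∫ p, ζ p ∂Φ.toMeasure)) := by
  rw [nhds_iInf, tendsto_iInf] at h
  have := h ⟨ζ, hζ⟩
  rw [nhds_induced, tendsto_comap_iff] at this
  exact this

/-- The functions used to identify the weak limit of the velocities. -/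
lemma isTestSW_abs_inner_sub (w : X) (g : BoundedContinuousFunction X ℝ) :
    IsTestSW fun p : X × X => |⟪w, p.2⟫ - g p.1| := by
  refine ⟨?_, ?_⟩
  · intro p p₀ hp
    rw [nhds_prod_eq] at hp
    exact ((tendsto_inner_of_tendsto_weakSpace (tendsto_snd.comp hp) w).sub
      ((g.continuous.tendsto _).comp (tendsto_fst.comp hp))).abs
  · intro ε hε
    refine ⟨‖g‖ + ‖w‖ ^ 2 / (4 * ε), by positivity, fun x v => ?_⟩
    have h1 : |⟪w, v⟫| ≤ ‖w‖ * ‖v‖ := abs_real_inner_le_norm w v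
    have h2 : |g x| ≤ ‖g‖ := g.norm_coe_le_norm x
    -- Young's inequality `‖w‖ ‖v‖ ≤ ‖w‖² / (4ε) + ε ‖v‖²`
    have h3 : ‖w‖ * ‖v‖ ≤ ‖w‖ ^ 2 / (4 * ε) + ε * ‖v‖ ^ 2 := by
      rw [← sub_nonneg]
      have : ‖w‖ ^ 2 / (4 * ε) + ε * ‖v‖ ^ 2 - ‖w‖ * ‖v‖
          = (‖w‖ - 2 * ε * ‖v‖) ^ 2 / (4 * ε) := by
        field_simp; ring
      rw [this]; positivity
    have h4 : 0 ≤ (‖g‖ + ‖w‖ ^ 2 / (4 * ε)) * ‖x‖ ^ 2 := by positivity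
    rw [abs_abs]
    have h5 := abs_sub (⟪w, v⟫) (g x)
    dsimp only
    linarith

lemma norm_sq_sub_norm_sub_sq (d v : X) :
    2 * ⟪d, v⟫ - ‖d‖ ^ 2 = ‖v‖ ^ 2 - ‖v - d‖ ^ 2 := by
  rw [norm_sub_sq_real, real_inner_comm d v]; ring

variable [TopologicalSpace.SeparableSpace X]

/-- Bounded weakly continuous approximations from below of `v ↦ ‖v‖²`, built from
`‖v‖² = sup_d (2 ⟪d, v⟫ - ‖d‖²)` with `d` in a dense sequence. -/
noncomputable def sqApprox (m : ℕ) (v : X) : ℝ :=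
  min (m : ℝ) (((Finset.range m).sup fun j => (2 * ⟪TopologicalSpace.denseSeq X j, v⟫
    - ‖TopologicalSpace.denseSeq X j‖ ^ 2).toNNReal : NNReal) : ℝ)

lemma sqApprox_nonneg (m : ℕ) (v : X) : 0 ≤ sqApprox m v :=
  le_min (Nat.cast_nonneg m) (NNReal.coe_nonneg _)

lemma sqApprox_le_nat (m : ℕ) (v : X) : sqApprox m v ≤ m := min_le_left _ _

lemma sqApprox_le_norm_sq (m : ℕ) (v : X) : sqApprox m v ≤ ‖v‖ ^ 2 := by
  refine (min_le_right _ _).trans ?_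
  have : ((Finset.range m).sup fun j => (2 * ⟪TopologicalSpace.denseSeq X j, v⟫
      - ‖TopologicalSpace.denseSeq X j‖ ^ 2).toNNReal) ≤ ‖v‖₊ ^ 2 := by
    refine Finset.sup_le fun j _ => ?_
    rw [Real.toNNReal_le_iff_le_coe, norm_sq_sub_norm_sub_sq]
    push_cast
    linarith [sq_nonneg ‖v - TopologicalSpace.denseSeq X j‖]
  exact_mod_cast this

lemma tendsto_sqApprox (v : X) : Tendsto (fun m => sqApprox m v) atTop (𝓝 (‖v‖ ^ 2)) := by
  rw [Metric.tendsto_atTop]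
  intro δ hδ
  obtain ⟨j, hj⟩ := (TopologicalSpace.denseRange_denseSeq X).exists_dist_lt v
    (Real.sqrt_pos.2 hδ)
  obtain ⟨M, hM⟩ := exists_nat_ge (‖v‖ ^ 2)
  refine ⟨max M (j + 1), fun m hm => ?_⟩
  have hm1 : (M : ℝ) ≤ m := by exact_mod_cast (le_max_left _ _).trans hm
  have hm2 : j < m := (le_max_right M (j + 1)).trans hm
  have h1 := sqApprox_le_norm_sq m v
  have h2 : ‖v‖ ^ 2 - δ < sqApprox m v := by
    refine lt_min (by linarith) ?_
    have h3 := Finset.le_sup (f := fun j => (2 * ⟪TopologicalSpace.denseSeq X j, v⟫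
      - ‖TopologicalSpace.denseSeq X j‖ ^ 2).toNNReal) (Finset.mem_range.2 hm2)
    refine lt_of_lt_of_le ?_ (NNReal.coe_le_coe.2 h3)
    refine lt_of_lt_of_le ?_ (Real.le_coe_toNNReal _)
    rw [norm_sq_sub_norm_sub_sq]
    rw [dist_eq_norm] at hj
    have := Real.lt_sqrt (norm_nonneg _) |>.1 hj
    linarith
  rw [Real.dist_eq, abs_lt]
  constructor <;> linarith

lemma tendsto_sqApprox_of_tendsto_weakSpace (m : ℕ) {v : ℕ → WeakSpace ℝ X}
    {v₀ : WeakSpace ℝ X} (h : Tendsto v atTop (𝓝 v₀)) :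
    Tendsto (fun n => sqApprox m ((toWeakSpace ℝ X).symm (v n))) atTop
      (𝓝 (sqApprox m ((toWeakSpace ℝ X).symm v₀))) := by
  refine tendsto_const_nhds.min (NNReal.tendsto_coe.2 ?_)
  refine Tendsto.finset_sup_nhds_apply fun j _ => ?_
  exact (continuous_real_toNNReal.tendsto _).comp
    (((tendsto_inner_of_tendsto_weakSpace h _).const_mul 2).sub_const _)

lemma summable_sqApprox (m : ℕ → ℕ) (v : X) :
    Summable fun k => (1 / 2 : ℝ) ^ k * sqApprox (m k) v :=
  Summable.of_nonneg_of_le (fun k => mul_nonneg (by positivity) (sqApprox_nonneg _ _))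
    (fun k => mul_le_mul_of_nonneg_left (sqApprox_le_norm_sq _ _) (by positivity))
    (summable_geometric_two.mul_right (‖v‖ ^ 2))

/-- A geometric series of the approximations `sqApprox` is again a test function. It dominates
each of its terms, which turns convergence in `𝒫₂^{sw}` into a bound on second moments. -/
lemma isTestSW_tsum_sqApprox [CompleteSpace X] (m : ℕ → ℕ) :
    IsTestSW fun p : X × X => ∑' k, (1 / 2 : ℝ) ^ k * sqApprox (m k) p.2 := by
  refine ⟨?_, ?_⟩
  · intro p p₀ hp
    rw [nhds_prod_eq] at hp
    have hv := tendsto_snd.comp hp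
    obtain ⟨C, hC⟩ := exists_norm_le_of_tendsto_weakSpace hv
    refine tendsto_tsum_of_dominated_convergence (bound := fun k => (1 / 2 : ℝ) ^ k * C ^ 2)
      (summable_geometric_two.mul_right _)
      (fun k => (tendsto_sqApprox_of_tendsto_weakSpace (m k) hv).const_mul _)
      (Eventually.of_forall fun n k => ?_)
    rw [Real.norm_of_nonneg (mul_nonneg (by positivity) (sqApprox_nonneg _ _))]
    refine mul_le_mul_of_nonneg_left ((sqApprox_le_norm_sq _ _).trans ?_) (by positivity)
    exact pow_le_pow_left₀ (norm_nonneg _) (hC n) 2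
  · intro ε hε
    -- the tail of the series beyond `K` is at most `2 (1/2)^K ‖v‖² ≤ ε ‖v‖²`
    obtain ⟨K, hK⟩ := exists_pow_lt_of_lt_one (half_pos hε) (by norm_num : (1 / 2 : ℝ) < 1)
    refine ⟨∑ k ∈ Finset.range K, (1 / 2 : ℝ) ^ k * m k, by positivity, fun x v => ?_⟩
    have hs := summable_sqApprox m v
    dsimp only
    rw [abs_of_nonneg (tsum_nonneg fun k => mul_nonneg (by positivity) (sqApprox_nonneg _ _)),
      ← hs.sum_add_tsum_nat_add K]
    have h1 : ∑ k ∈ Finset.range K, (1 / 2 : ℝ) ^ k * sqApprox (m k) v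
        ≤ ∑ k ∈ Finset.range K, (1 / 2 : ℝ) ^ k * m k :=
      Finset.sum_le_sum fun k _ => mul_le_mul_of_nonneg_left (sqApprox_le_nat _ _) (by positivity)
    have h2 : ∑' k, (1 / 2 : ℝ) ^ (k + K) * sqApprox (m (k + K)) v
        ≤ ∑' k : ℕ, (1 / 2 : ℝ) ^ k * ((1 / 2) ^ K * ‖v‖ ^ 2) := by
      refine Summable.tsum_le_tsum (fun k => ?_)
        ((summable_nat_add_iff (f := fun k => (1 / 2 : ℝ) ^ k * sqApprox (m k) v) K).2 hs)
        (summable_geometric_two.mul_right _)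
      rw [pow_add, mul_assoc]
      gcongr
      exact sqApprox_le_norm_sq _ _
    rw [tsum_mul_right, tsum_geometric_two] at h2
    have h3 : (0 : ℝ) ≤ (∑ k ∈ Finset.range K, (1 / 2 : ℝ) ^ k * m k) * ‖x‖ ^ 2 := by positivity
    have h4 : (1 / 2 : ℝ) ^ K * ‖v‖ ^ 2 ≤ ε / 2 * ‖v‖ ^ 2 :=
      mul_le_mul_of_nonneg_right hK.le (by positivity)
    linarith

end TestFunctions

/-! ### Moment bounds from strong-weak convergence -/

section Moments

variable {E : Type*} [NormedAddCommGroup E] [MeasurableSpace E] [BorelSpace E]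

lemma P2.integrable_norm_sq (μ : P2 E) : Integrable (fun x => ‖x‖ ^ 2) μ.toMeasure := by
  refine ⟨(by fun_prop : Measurable fun x : E => ‖x‖ ^ 2).aestronglyMeasurable, ?_⟩
  simpa [HasFiniteIntegral, enorm_pow] using μ.moment

lemma P2.integrable_norm_snd_sq [SecondCountableTopology E] (Φ : P2 (E × E)) :
    Integrable (fun p => ‖p.2‖ ^ 2) Φ.toMeasure := by
  refine Φ.integrable_norm_sq.mono' (by fun_prop) (Eventually.of_forall fun p => ?_)
  rw [Real.norm_of_nonneg (by positivity)]
  exact pow_le_pow_left₀ (norm_nonneg _) (norm_snd_le p) 2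

variable {X : Type*} [NormedAddCommGroup X] [InnerProductSpace ℝ X]
  [MeasurableSpace X] [BorelSpace X] [SecondCountableTopology X]

lemma IsTestSW.integrable {ζ : X × X → ℝ} (hζ : IsTestSW ζ) (Φ : P2 (X × X)) :
    Integrable ζ Φ.toMeasure := by
  obtain ⟨A, hA, h⟩ := hζ.2 1 one_pos
  refine (((integrable_const A).add (Φ.integrable_norm_sq.const_mul A)).add
    (Φ.integrable_norm_sq.const_mul 1)).mono' hζ.continuous.measurable.aestronglyMeasurable
    (Eventually.of_forall fun p => ?_)
  refine (h p.1 p.2).trans ?_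
  have h1 : ‖p.1‖ ^ 2 ≤ ‖p‖ ^ 2 := pow_le_pow_left₀ (norm_nonneg _) (norm_fst_le p) 2
  have h2 : ‖p.2‖ ^ 2 ≤ ‖p‖ ^ 2 := pow_le_pow_left₀ (norm_nonneg _) (norm_snd_le p) 2
  have h3 := mul_le_mul_of_nonneg_left h1 hA
  simp only [Pi.add_apply]
  linarith

/-- Velocities are bounded in `L²` along a sequence that converges in `𝒫₂^{sw}(TX)`. If not,
`∫ sqApprox mₖ(v) dΦₙₖ ≥ 4ᵏ` for suitable `mₖ`, `nₖ`, and the integrals of the test function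
`∑ 2⁻ᵏ sqApprox mₖ` would be unbounded. -/
lemma exists_integral_norm_snd_sq_le [CompleteSpace X] {Φn : ℕ → P2 (X × X)} {Φ : P2 (X × X)}
    (h : Tendsto Φn atTop (@nhds _ (swTopology X) Φ)) :
    ∃ C, ∀ n, ∫ p, ‖p.2‖ ^ 2 ∂(Φn n).toMeasure ≤ C := by
  by_contra! hcon
  choose n hn using fun k : ℕ => hcon ((4 : ℝ) ^ k)
  have hm : ∀ k, ∃ m : ℕ, (4 : ℝ) ^ k < ∫ p, sqApprox m p.2 ∂(Φn (n k)).toMeasure := by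
    intro k
    have hlim : Tendsto (fun m => ∫ p, sqApprox m p.2 ∂(Φn (n k)).toMeasure) atTop
        (𝓝 (∫ p, ‖p.2‖ ^ 2 ∂(Φn (n k)).toMeasure)) := by
      refine tendsto_integral_of_dominated_convergence (fun p => ‖p.2‖ ^ 2) (fun m => ?_)
        (Φn (n k)).integrable_norm_snd_sq (fun m => Eventually.of_forall fun p => ?_)
        (Eventually.of_forall fun p => tendsto_sqApprox p.2)
      · have hcont : Continuous fun v : X => sqApprox m v := by
          have : SeqContinuous fun v : X => sqApprox m v := fun v v₀ hv =>
            tendsto_sqApprox_of_tendsto_weakSpace m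
              (((toWeakSpaceCLM ℝ X).continuous.tendsto v₀).comp hv)
          exact this.continuous
        exact (hcont.comp continuous_snd).measurable.aestronglyMeasurable
      · rw [Real.norm_of_nonneg (sqApprox_nonneg _ _)]
        exact sqApprox_le_norm_sq _ _
    exact (hlim.eventually (lt_mem_nhds (hn k))).exists
  choose m hm using hm
  have htest := isTestSW_tsum_sqApprox (X := X) m
  obtain ⟨C, hC⟩ := (htest.tendsto_integral h).bddAbove_range
  have hlow : ∀ k, (2 : ℝ) ^ k ≤ C := by
    intro k
    have h1 : ∫ p, (1 / 2 : ℝ) ^ k * sqApprox (m k) p.2 ∂(Φn (n k)).toMeasure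
        ≤ ∫ p, ∑' k, (1 / 2 : ℝ) ^ k * sqApprox (m k) p.2 ∂(Φn (n k)).toMeasure := by
      refine integral_mono_of_nonneg
        (Eventually.of_forall fun p => mul_nonneg (by positivity) (sqApprox_nonneg _ _))
        (htest.integrable _) (Eventually.of_forall fun p => ?_)
      exact (summable_sqApprox m p.2).le_tsum k
        fun j _ => mul_nonneg (by positivity) (sqApprox_nonneg _ _)
    have h2 : (1 / 2 : ℝ) ^ k * 4 ^ k = 2 ^ k := by rw [← mul_pow]; norm_num
    rw [integral_const_mul] at h1
    have h3 := mul_le_mul_of_nonneg_left (hm k).le (by positivity : (0 : ℝ) ≤ (1 / 2) ^ k)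
    rw [h2] at h3
    exact h3.trans (h1.trans (hC ⟨n k, rfl⟩))
  obtain ⟨k, hk⟩ := pow_unbounded_of_one_lt C (by norm_num : (1 : ℝ) < 2)
  exact absurd (hlow k) (not_le.2 hk)

end Moments

/-! ### Random variables, their laws, and the operator induced by a vector field -/

section SquareIntegrable

variable {X : Type*} [NormedAddCommGroup X] {Ω : Type*} [MeasurableSpace Ω] {P : Measure Ω}

lemma lintegral_enorm_sq_lt_top {f : Ω → X} (hf : MemLp f 2 P) : ∫⁻ ω, ‖f ω‖ₑ ^ 2 ∂P < ∞ := by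
  have := (memLp_two_iff_integrable_sq_norm hf.1).1 hf |>.2
  simpa [HasFiniteIntegral, enorm_pow] using this

lemma P2.memLp_id {E : Type*} [NormedAddCommGroup E] [MeasurableSpace E] [BorelSpace E]
    [SecondCountableTopology E] (μ : P2 E) : MemLp (fun x : E => x) 2 μ.toMeasure :=
  (memLp_two_iff_integrable_sq_norm measurable_id.aestronglyMeasurable).2 μ.integrable_norm_sq

lemma L2_norm_sq [InnerProductSpace ℝ X] (Z : Lp X 2 P) : ‖Z‖ ^ 2 = ∫ ω, ‖Z ω‖ ^ 2 ∂P := by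
  rw [← real_inner_self_eq_norm_sq, L2.inner_def]
  simp only [real_inner_self_eq_norm_sq]

lemma measurable_coeFn [MeasurableSpace X] [BorelSpace X] (Z : Lp X 2 P) : Measurable Z :=
  (Lp.stronglyMeasurable Z).measurable

lemma bddBelow_cost_image [MeasurableSpace X] (S : Set (Measure (X × X))) :
    BddBelow ((fun γ : Measure (X × X) => ∫ p, ‖p.1 - p.2‖ ^ 2 ∂γ) '' S) :=
  ⟨0, by rintro _ ⟨γ, -, rfl⟩; exact integral_nonneg fun p => by positivity⟩

/-- Deterministic fields `μ ↦ (id, b(·, μ))_♯ μ`, with everywhere measurable representatives. -/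
structure VelocityField (X : Type*) [NormedAddCommGroup X] [MeasurableSpace X] where
  toFun : P2 X → X → X
  measurable : ∀ μ, Measurable (toFun μ)
  memLp : ∀ μ, MemLp (toFun μ) 2 μ.toMeasure

lemma VelocityField.measurable_id_prodMk [MeasurableSpace X] (b : VelocityField X) (μ : P2 X) :
    Measurable fun x => (x, b.toFun μ x) :=
  measurable_id.prodMk (b.measurable μ)

lemma isClosed_setOf_tendsto_inner_zero {H : Type*} [NormedAddCommGroup H]
    [InnerProductSpace ℝ H] {u : ℕ → H} {C : ℝ} (hC : ∀ n, ‖u n‖ ≤ C) :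
    IsClosed {w : H | Tendsto (fun n => ⟪w, u n⟫) atTop (𝓝 0)} := by
  have hC0 : 0 ≤ C := (norm_nonneg _).trans (hC 0)
  refine isClosed_of_closure_subset fun w hw => ?_
  refine Metric.tendsto_atTop.2 fun ε hε => ?_
  obtain ⟨w', hw', hd⟩ := Metric.mem_closure_iff.1 hw (ε / 2 / (C + 1)) (by positivity)
  obtain ⟨N, hN⟩ := Metric.tendsto_atTop.1 hw' (ε / 2) (half_pos hε)
  refine ⟨N, fun n hn => ?_⟩
  have h1 := hN n hn
  rw [Real.dist_eq, sub_zero] at h1 ⊢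
  have h2 : ⟪w, u n⟫ = ⟪w - w', u n⟫ + ⟪w', u n⟫ := by rw [inner_sub_left]; ring
  have h3 : |⟪w - w', u n⟫| ≤ ε / 2 := by
    refine (abs_real_inner_le_norm _ _).trans ?_
    rw [dist_eq_norm, lt_div_iff₀ (by positivity)] at hd
    have := mul_le_mul_of_nonneg_left (hC n) (norm_nonneg (w - w'))
    linarith [norm_nonneg (w - w')]
  rw [h2]
  exact (abs_add_le _ _).trans_lt (by linarith)

end SquareIntegrable

section Lagrangian

variable {X : Type*} [NormedAddCommGroup X] [MeasurableSpace X] [BorelSpace X]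
  [SecondCountableTopology X]
variable {Ω : Type*} [MeasurableSpace Ω] {P : Measure Ω}

lemma integral_cost_map_pair [InnerProductSpace ℝ X] (Z₀ Z₁ : Lp X 2 P) :
    ∫ p, ‖p.1 - p.2‖ ^ 2 ∂(P.map fun ω => (Z₀ ω, Z₁ ω)) = ‖Z₀ - Z₁‖ ^ 2 := by
  have h₀ := measurable_coeFn Z₀
  have h₁ := measurable_coeFn Z₁
  rw [integral_map (h₀.prodMk h₁).aemeasurable (by fun_prop), L2_norm_sq]
  refine integral_congr_ae ?_
  filter_upwards [Lp.coeFn_sub Z₀ Z₁] with ω hω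
  rw [hω, Pi.sub_apply]

variable [IsProbabilityMeasure P]

/-- The law of a square integrable random variable. -/
noncomputable def law (Z : Lp X 2 P) : P2 X where
  toMeasure := P.map Z
  isProb := Measure.isProbabilityMeasure_map (measurable_coeFn Z).aemeasurable
  moment := by
    rw [lintegral_map (by fun_prop) (measurable_coeFn Z)]
    exact lintegral_enorm_sq_lt_top (Lp.memLp Z)

lemma map_pair_mem_couplings (Z₀ Z₁ : Lp X 2 P) :
    P.map (fun ω => (Z₀ ω, Z₁ ω)) ∈ couplings (law Z₀).toMeasure (law Z₁).toMeasure := by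
  have h₀ := measurable_coeFn Z₀
  have h₁ := measurable_coeFn Z₁
  exact ⟨Measure.map_map measurable_fst (h₀.prodMk h₁),
    Measure.map_map measurable_snd (h₀.prodMk h₁)⟩

lemma W2_law_le [InnerProductSpace ℝ X] (Z₀ Z₁ : Lp X 2 P) :
    W2 (law Z₀) (law Z₁) ≤ ‖Z₀ - Z₁‖ := by
  refine Real.sqrt_le_iff.2 ⟨norm_nonneg _, ?_⟩
  rw [← integral_cost_map_pair]
  exact csInf_le (bddBelow_cost_image _) ⟨_, map_pair_mem_couplings Z₀ Z₁, rfl⟩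

namespace VelocityField

/-- The element `(id, b(·, μ))_♯ μ` of `𝒫₂(TX)`. -/
noncomputable def graph (b : VelocityField X) (μ : P2 X) : P2 (X × X) where
  toMeasure := μ.toMeasure.map fun x => (x, b.toFun μ x)
  isProb := Measure.isProbabilityMeasure_map (b.measurable_id_prodMk μ).aemeasurable
  moment := by
    rw [lintegral_map (by fun_prop) (b.measurable_id_prodMk μ)]
    exact lintegral_enorm_sq_lt_top (MemLp.of_fst_snd ⟨μ.memLp_id, b.memLp μ⟩)

lemma base_graph (b : VelocityField X) (μ : P2 X) : (b.graph μ).base = μ := by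
  refine P2.ext ?_
  exact (Measure.map_map measurable_fst (b.measurable_id_prodMk μ)).trans
    Measure.map_id

/-- The law-invariant operator `Z ↦ b(Z, law Z)` on `L²(Ω; X)`. -/
noncomputable def act (b : VelocityField X) (Z : Lp X 2 P) : Lp X 2 P :=
  MemLp.toLp (fun ω => b.toFun (law Z) (Z ω))
    ((memLp_map_measure_iff (b.measurable _).aestronglyMeasurable
      (measurable_coeFn Z).aemeasurable).1 (b.memLp (law Z)))

lemma coeFn_act (b : VelocityField X) (Z : Lp X 2 P) :
    b.act Z =ᵐ[P] fun ω => b.toFun (law Z) (Z ω) :=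
  MemLp.coeFn_toLp _

lemma graph_law (b : VelocityField X) (Z : Lp X 2 P) :
    (b.graph (law Z)).toMeasure = P.map fun ω => (Z ω, b.act Z ω) := by
  refine (Measure.map_map (b.measurable_id_prodMk _) (measurable_coeFn Z)).trans ?_
  refine Measure.map_congr ?_
  filter_upwards [b.coeFn_act Z] with ω hω
  rw [hω]; rfl

lemma integral_graph_law (b : VelocityField X) (Z : Lp X 2 P) {ζ : X × X → ℝ}
    (hζ : Measurable ζ) :
    ∫ p, ζ p ∂(b.graph (law Z)).toMeasure = ∫ ω, ζ (Z ω, b.act Z ω) ∂P := by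
  rw [b.graph_law, integral_map ((measurable_coeFn Z).prodMk (measurable_coeFn _)).aemeasurable
    hζ.aestronglyMeasurable]

/-! ### Demicontinuity of the induced operator -/

variable [InnerProductSpace ℝ X]

lemma tendsto_graph_law {b : VelocityField X} (hb : IsDemicontinuous (Set.range b.graph))
    {Zn : ℕ → Lp X 2 P} {Z : Lp X 2 P} (h : Tendsto Zn atTop (𝓝 Z)) :
    Tendsto (fun n => b.graph (law (Zn n))) atTop (@nhds _ (swTopology X) (b.graph (law Z))) := by
  refine hb _ _ (fun n => ⟨_, rfl⟩) ⟨_, rfl⟩ ?_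
  simp only [base_graph]
  exact squeeze_zero (fun n => Real.sqrt_nonneg _) (fun n => W2_law_le (Zn n) Z)
    (tendsto_iff_norm_sub_tendsto_zero.1 h)

lemma exists_norm_act_le [CompleteSpace X] {b : VelocityField X}
    (hb : IsDemicontinuous (Set.range b.graph)) {Zn : ℕ → Lp X 2 P} {Z : Lp X 2 P}
    (h : Tendsto Zn atTop (𝓝 Z)) : ∃ C, ∀ n, ‖b.act (Zn n)‖ ≤ C := by
  obtain ⟨C, hC⟩ := exists_integral_norm_snd_sq_le (tendsto_graph_law hb h)
  refine ⟨√C, fun n => Real.le_sqrt_of_sq_le ?_⟩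
  rw [L2_norm_sq]
  refine le_trans (le_of_eq ?_) (hC n)
  exact (b.integral_graph_law (Zn n) (ζ := fun p => ‖p.2‖ ^ 2) (by fun_prop)).symm

/-- If `Zₙ → Z` in `L²`, every scalar component of `b(Zₙ, law Zₙ)` converges in `L¹`. Replacing
`⟪c, b(·, law Z)⟫` by a bounded continuous `g` close to it in `L¹(law Z)`, the error
`𝔼|⟪c, b(Zₙ, law Zₙ)⟫ - g(Zₙ)|` is the integral of a test function. -/
lemma tendsto_integral_abs_inner_act_sub {b : VelocityField X}
    (hb : IsDemicontinuous (Set.range b.graph)) {Zn : ℕ → Lp X 2 P} {Z : Lp X 2 P}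
    (h : Tendsto Zn atTop (𝓝 Z)) (c : X) :
    Tendsto (fun n => ∫ ω, |⟪c, b.act (Zn n) ω⟫ - ⟪c, b.act Z ω⟫| ∂P) atTop (𝓝 0) := by
  refine tendsto_of_subseq_tendsto fun ns hns => ?_
  obtain ⟨ms, hms, hae⟩ := (tendstoInMeasure_of_tendsto_Lp (h.comp hns)).exists_seq_tendsto_ae
  refine ⟨ms, ?_⟩
  set Y : ℕ → Lp X 2 P := fun n => Zn (ns (ms n)) with hY
  have hYZ : Tendsto Y atTop (𝓝 Z) := (h.comp hns).comp hms.tendsto_atTop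
  have hint : ∀ V : Lp X 2 P, Integrable (fun ω => ⟪c, V ω⟫) P := fun V =>
    ((Lp.memLp V).integrable (by norm_num)).const_inner c
  have hbint : Integrable (fun x => ⟪c, b.toFun (law Z) x⟫) (law Z).toMeasure :=
    ((b.memLp (law Z)).integrable (by norm_num)).const_inner c
  rw [Metric.tendsto_atTop']
  intro ε hε
  obtain ⟨g, hg, -⟩ := hbint.exists_boundedContinuous_integral_sub_le
    (ε := ε / 4) (by linarith)
  have hgint : ∀ V : Lp X 2 P, Integrable (fun ω => g (V ω)) P := fun V =>
    Integrable.of_bound ((g.continuous.measurable.comp (measurable_coeFn V)).aestronglyMeasurable)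
      ‖g‖ (Eventually.of_forall fun ω => g.norm_coe_le_norm _)
  have hI₁ : ∀ U V : Lp X 2 P, Integrable (fun ω => |⟪c, U ω⟫ - g (V ω)|) P := fun U V =>
    ((hint U).sub (hgint V)).abs
  have hI₂ : ∀ U V : Lp X 2 P, Integrable (fun ω => |g (U ω) - g (V ω)|) P := fun U V =>
    ((hgint U).sub (hgint V)).abs
  have htest := isTestSW_abs_inner_sub c g
  have hA := htest.tendsto_integral (tendsto_graph_law hb hYZ)
  simp only [b.integral_graph_law _ htest.continuous.measurable] at hA
  have hA0 : ∫ ω, |⟪c, b.act Z ω⟫ - g (Z ω)| ∂P ≤ ε / 4 := by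
    refine le_trans (le_of_eq ?_) hg
    refine Eq.trans ?_ (integral_map (measurable_coeFn Z).aemeasurable ?_).symm
    · refine integral_congr_ae ?_
      filter_upwards [b.coeFn_act Z] with ω hω
      rw [hω, Real.norm_eq_abs]
    · have := b.measurable (law Z)
      have hgm := g.continuous.measurable
      exact Measurable.aestronglyMeasurable (by fun_prop)
  have hG : Tendsto (fun n => ∫ ω, |g (Y n ω) - g (Z ω)| ∂P) atTop (𝓝 0) := by
    have := tendsto_integral_of_dominated_convergence (μ := P) (fun _ => ‖g‖ + ‖g‖)
      (F := fun n ω => |g (Y n ω) - g (Z ω)|) (f := fun _ => 0)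
      (fun n => ((hgint _).sub (hgint _)).abs.aestronglyMeasurable) (integrable_const _)
      (fun n => Eventually.of_forall fun ω => ?_) ?_
    · simpa using this
    · rw [Real.norm_eq_abs, abs_abs]
      exact (abs_sub _ _).trans (add_le_add (g.norm_coe_le_norm _) (g.norm_coe_le_norm _))
    · filter_upwards [hae] with ω hω
      have := (((g.continuous.tendsto _).comp hω).sub_const (g (Z ω))).abs
      simpa using this
  have hsum := hA.add hG
  rw [add_zero] at hsum
  obtain ⟨N, hN⟩ := eventually_atTop.1
    (hsum.eventually (gt_mem_nhds (lt_of_le_of_lt hA0 (by linarith : ε / 4 < ε / 2))))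
  refine ⟨N, fun n hn => ?_⟩
  have hn' := hN n hn.le
  rw [Real.dist_eq, sub_zero, abs_of_nonneg (integral_nonneg fun ω => abs_nonneg _)]
  have hle : ∫ ω, |⟪c, b.act (Y n) ω⟫ - ⟪c, b.act Z ω⟫| ∂P
      ≤ ∫ ω, (|⟪c, b.act (Y n) ω⟫ - g (Y n ω)| + |g (Y n ω) - g (Z ω)|)
        + |⟪c, b.act Z ω⟫ - g (Z ω)| ∂P := by
    refine integral_mono ((hint _).sub (hint _)).abs
      (((hI₁ _ _).add (hI₂ _ _)).add (hI₁ _ _)) fun ω => ?_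
    have e1 := abs_sub_le ⟪c, b.act (Y n) ω⟫ (g (Y n ω)) ⟪c, b.act Z ω⟫
    have e2 := abs_sub_le (g (Y n ω)) (g (Z ω)) ⟪c, b.act Z ω⟫
    rw [abs_sub_comm (g (Z ω))] at e2
    dsimp only
    linarith
  have hI₃ : Integrable (fun ω => |⟪c, b.act (Y n) ω⟫ - g (Y n ω)| + |g (Y n ω) - g (Z ω)|) P :=
    (hI₁ _ _).add (hI₂ _ _)
  rw [integral_add hI₃ (hI₁ _ _), integral_add (hI₁ _ _) (hI₂ _ _)] at hle
  change ∫ ω, |⟪c, b.act (Y n) ω⟫ - ⟪c, b.act Z ω⟫| ∂P < ε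
  linarith

/-- The operator `Z ↦ b(Z, law Z)` is continuous from the strong to the weak topology of `L²`. -/
theorem tendsto_inner_act [CompleteSpace X] {b : VelocityField X}
    (hb : IsDemicontinuous (Set.range b.graph)) {Zn : ℕ → Lp X 2 P} {Z : Lp X 2 P}
    (h : Tendsto Zn atTop (𝓝 Z)) (W : Lp X 2 P) :
    Tendsto (fun n => ⟪W, b.act (Zn n)⟫) atTop (𝓝 ⟪W, b.act Z⟫) := by
  obtain ⟨C, hC⟩ := exists_norm_act_le hb h
  suffices H : Tendsto (fun n => ⟪W, b.act (Zn n) - b.act Z⟫) atTop (𝓝 0) by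
    simp only [inner_sub_right] at H
    simpa using H.add_const ⟪W, b.act Z⟫
  refine Lp.induction (by norm_num)
    (fun W => Tendsto (fun n => ⟪W, b.act (Zn n) - b.act Z⟫) atTop (𝓝 0)) ?_ ?_ ?_ W
  · intro c s hs hμs
    rw [Lp.simpleFunc.coe_indicatorConst]
    refine squeeze_zero_norm (fun n => ?_) (tendsto_integral_abs_inner_act_sub hb h c)
    rw [L2.inner_indicatorConstLp_eq_setIntegral_inner]
    have hint : ∀ V : Lp X 2 P, Integrable (fun ω => ⟪c, V ω⟫) P := fun V =>
      ((Lp.memLp V).integrable (by norm_num)).const_inner c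
    refine (norm_integral_le_integral_norm _).trans ?_
    refine (setIntegral_le_integral (hint _).norm (Eventually.of_forall fun ω => norm_nonneg _)).trans
      (le_of_eq ?_)
    refine integral_congr_ae ?_
    filter_upwards [Lp.coeFn_sub (b.act (Zn n)) (b.act Z)] with ω hω
    rw [hω, Pi.sub_apply, inner_sub_right, Real.norm_eq_abs]
  · intro f g hf hg _ h1 h2
    simp only [inner_add_left]
    simpa using h1.add h2
  · exact isClosed_setOf_tendsto_inner_zero (C := C + ‖b.act Z‖) fun n =>
      (norm_sub_le _ _).trans (by gcongr; exact hC n)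

/-- Pairing of weak convergence of velocities with strong convergence of test vectors. -/
lemma tendsto_inner_act_of_tendsto [CompleteSpace X] {b : VelocityField X}
    (hb : IsDemicontinuous (Set.range b.graph)) {Zn Wn : ℕ → Lp X 2 P} {Z W : Lp X 2 P}
    (h : Tendsto Zn atTop (𝓝 Z)) (hW : Tendsto Wn atTop (𝓝 W)) :
    Tendsto (fun n => ⟪Wn n, b.act (Zn n)⟫) atTop (𝓝 ⟪W, b.act Z⟫) := by
  obtain ⟨C, hC⟩ := exists_norm_act_le hb h
  have h1 : Tendsto (fun n => ⟪Wn n - W, b.act (Zn n)⟫) atTop (𝓝 0) := by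
    refine squeeze_zero_norm (a := fun n => ‖Wn n - W‖ * C) (fun n => ?_) ?_
    · exact (norm_inner_le_norm _ _).trans (mul_le_mul_of_nonneg_left (hC n) (norm_nonneg _))
    · simpa using (tendsto_iff_norm_sub_tendsto_zero.1 hW).mul_const C
  simpa [inner_sub_left] using h1.add (tendsto_inner_act hb h W)

end VelocityField

end Lagrangian

/-! ### Uniqueness of optimal couplings for nearby discrete random variables -/

section Matching

lemma W2_sq {X : Type*} [NormedAddCommGroup X] [MeasurableSpace X] (μ ν : P2 X) :
    W2 μ ν ^ 2 = sInf ((fun γ : Measure (X × X) =>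
      ∫ p, ‖p.1 - p.2‖ ^ 2 ∂γ) '' couplings μ.toMeasure ν.toMeasure) :=
  Real.sq_sqrt (Real.sInf_nonneg (by
    rintro _ ⟨γ, -, rfl⟩; exact integral_nonneg fun p => by positivity))

variable {X : Type*} [NormedAddCommGroup X] [MeasurableSpace X] [BorelSpace X]
  [SecondCountableTopology X]
variable {Ω : Type*} [MeasurableSpace Ω] {P : Measure Ω}

lemma integrable_cost {μ ν : P2 X} {γ : Measure (X × X)}
    (hγ : γ ∈ couplings μ.toMeasure ν.toMeasure) : Integrable (fun p => ‖p.1 - p.2‖ ^ 2) γ := by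
  have h1 : MemLp (fun p : X × X => p.1) 2 γ := by
    have := μ.memLp_id
    rw [← hγ.1] at this
    exact (memLp_map_measure_iff measurable_id.aestronglyMeasurable
      measurable_fst.aemeasurable).1 this
  have h2 : MemLp (fun p : X × X => p.2) 2 γ := by
    have := ν.memLp_id
    rw [← hγ.2] at this
    exact (memLp_map_measure_iff measurable_id.aestronglyMeasurable
      measurable_snd.aemeasurable).1 this
  have h3 := h1.sub h2
  exact (memLp_two_iff_integrable_sq_norm h3.1).1 h3

/-- If `u` and `v` take finitely many values and `v ω` is always the strictly nearest value of `v`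
to `u ω`, then the joint law of `u` and `v` has the least cost among the couplings of the two
laws, and it is the only coupling with that cost. -/
lemma cost_le_and_eq_of_nearest {u v : Ω → X} (hu : Measurable u) (hv : Measurable v)
    (hu' : (Set.range u).Finite) (hv' : (Set.range v).Finite)
    (hn : ∀ ω ω', v ω' = v ω ∨ ‖u ω - v ω‖ < ‖u ω - v ω'‖) {μ ν : P2 X}
    (hμ : μ.toMeasure = P.map u) (hν : ν.toMeasure = P.map v) {γ : Measure (X × X)}
    (hγ : γ ∈ couplings μ.toMeasure ν.toMeasure) :
    ∫ ω, ‖u ω - v ω‖ ^ 2 ∂P ≤ ∫ p, ‖p.1 - p.2‖ ^ 2 ∂γ ∧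
      (∫ p, ‖p.1 - p.2‖ ^ 2 ∂γ ≤ ∫ ω, ‖u ω - v ω‖ ^ 2 ∂P →
        γ = P.map fun ω => (u ω, v ω)) := by
  -- `v` is a function of `u`, because the nearest value is determined by `u ω`
  have hfac : Function.FactorsThrough v u := by
    intro ω ω' h
    rcases hn ω ω' with h1 | h1
    · exact h1.symm
    rcases hn ω' ω with h2 | h2
    · exact h2
    rw [h] at h1
    exact absurd h1 h2.not_gt
  set T : X → X := Function.extend u v 0
  have hTu : ∀ ω, T (u ω) = v ω := hfac.extend_apply 0
  have hTm : Measurable T := by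
    refine measurable_of_measurable_on_compl_finite _ hu' ?_
    have : (Set.range u)ᶜ.domRestrict T = fun _ => 0 := by
      funext x
      exact Function.extend_apply' _ _ _ x.2
    rw [this]
    exact measurable_const
  have hmem1 : ∀ᵐ p ∂γ, p.1 ∈ Set.range u := by
    have : ∀ᵐ x ∂(γ.map Prod.fst), x ∈ Set.range u := by
      rw [hγ.1, hμ]
      exact (ae_map_iff hu.aemeasurable hu'.measurableSet).2
        (Eventually.of_forall fun ω => ⟨ω, rfl⟩)
    exact ae_of_ae_map measurable_fst.aemeasurable this
  have hmem2 : ∀ᵐ p ∂γ, p.2 ∈ Set.range v := by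
    have : ∀ᵐ x ∂(γ.map Prod.snd), x ∈ Set.range v := by
      rw [hγ.2, hν]
      exact (ae_map_iff hv.aemeasurable hv'.measurableSet).2
        (Eventually.of_forall fun ω => ⟨ω, rfl⟩)
    exact ae_of_ae_map measurable_snd.aemeasurable this
  have hnear : ∀ᵐ p ∂γ, p.2 = T p.1 ∨ ‖p.1 - T p.1‖ < ‖p.1 - p.2‖ := by
    filter_upwards [hmem1, hmem2] with p hp1 hp2
    obtain ⟨ω, hω⟩ := hp1
    obtain ⟨ω', hω'⟩ := hp2
    rw [← hω, ← hω', hTu]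
    exact hn ω ω'
  have hle : ∀ᵐ p ∂γ, ‖p.1 - T p.1‖ ^ 2 ≤ ‖p.1 - p.2‖ ^ 2 := by
    filter_upwards [hnear] with p hp
    rcases hp with hp | hp
    · rw [hp]
    · exact pow_le_pow_left₀ (norm_nonneg _) hp.le 2
  have hint := integrable_cost hγ
  have hint' : Integrable (fun p : X × X => ‖p.1 - T p.1‖ ^ 2) γ := by
    refine hint.mono' (by fun_prop) ?_
    filter_upwards [hle] with p hp
    rwa [Real.norm_of_nonneg (by positivity)]
  have hcost : ∫ p, ‖p.1 - T p.1‖ ^ 2 ∂γ = ∫ ω, ‖u ω - v ω‖ ^ 2 ∂P := by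
    have e1 : ∫ x, ‖x - T x‖ ^ 2 ∂(γ.map Prod.fst) = ∫ p, ‖p.1 - T p.1‖ ^ 2 ∂γ :=
      integral_map measurable_fst.aemeasurable (by fun_prop)
    rw [← e1, hγ.1, hμ, integral_map hu.aemeasurable (by fun_prop)]
    simp only [hTu]
  refine ⟨hcost ▸ integral_mono_ae hint' hint hle, fun hopt => ?_⟩
  rw [← hcost] at hopt
  have hzero : ∫ p, (‖p.1 - p.2‖ ^ 2 - ‖p.1 - T p.1‖ ^ 2) ∂γ = 0 := by
    rw [integral_sub hint hint']
    linarith [integral_mono_ae hint' hint hle]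
  have hae := (integral_eq_zero_iff_of_nonneg_ae
    (by filter_upwards [hle] with p hp using sub_nonneg.2 hp) (hint.sub hint')).1 hzero
  have heq : (fun p : X × X => p) =ᵐ[γ] fun p => (p.1, T p.1) := by
    filter_upwards [hnear, hae] with p hp hp0
    rcases hp with hp | hp
    · exact Prod.ext rfl hp
    · have := pow_lt_pow_left₀ hp (norm_nonneg _) two_ne_zero
      simp only [Pi.zero_apply, Pi.sub_apply] at hp0
      linarith
  have hTg : Measurable fun x => (x, T x) := measurable_id.prodMk hTm
  calc γ = γ.map fun p => p := Measure.map_id.symm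
    _ = γ.map fun p => (p.1, T p.1) := Measure.map_congr heq
    _ = (γ.map Prod.fst).map fun x => (x, T x) :=
      (Measure.map_map hTg measurable_fst).symm
    _ = P.map fun ω => (u ω, v ω) := by
      rw [hγ.1, hμ, Measure.map_map hTg hu]
      simp only [Function.comp_def, hTu]

variable [IsProbabilityMeasure P]

/-- The joint law of `Z₀` and `Z₁` is the one and only optimal coupling of their laws. -/
def IsUniquelyMatched (Z₀ Z₁ : Lp X 2 P) : Prop :=
  optimalCouplings (law Z₀) (law Z₁) = {P.map fun ω => (Z₀ ω, Z₁ ω)}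

lemma isUniquelyMatched_of_nearest {u v : Ω → X} (hu : Measurable u) (hv : Measurable v)
    (hu' : (Set.range u).Finite) (hv' : (Set.range v).Finite)
    (hn : ∀ ω ω', v ω' = v ω ∨ ‖u ω - v ω‖ < ‖u ω - v ω'‖) {Z₀ Z₁ : Lp X 2 P}
    (h₀ : Z₀ =ᵐ[P] u) (h₁ : Z₁ =ᵐ[P] v) : IsUniquelyMatched Z₀ Z₁ := by
  have hμ : (law Z₀).toMeasure = P.map u := Measure.map_congr h₀
  have hν : (law Z₁).toMeasure = P.map v := Measure.map_congr h₁
  have hpair : (P.map fun ω => (Z₀ ω, Z₁ ω)) = P.map fun ω => (u ω, v ω) := by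
    refine Measure.map_congr ?_
    filter_upwards [h₀, h₁] with ω e₀ e₁
    rw [e₀, e₁]
  have hcost : ∫ p, ‖p.1 - p.2‖ ^ 2 ∂(P.map fun ω => (Z₀ ω, Z₁ ω))
      = ∫ ω, ‖u ω - v ω‖ ^ 2 ∂P := by
    rw [hpair, integral_map (hu.prodMk hv).aemeasurable (by fun_prop)]
  have key := fun γ hγ => cost_le_and_eq_of_nearest (P := P) (γ := γ) hu hv hu' hv' hn hμ hν hγ
  have hW : W2 (law Z₀) (law Z₁) ^ 2 = ∫ ω, ‖u ω - v ω‖ ^ 2 ∂P := by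
    rw [W2_sq]
    refine IsLeast.csInf_eq ⟨⟨_, map_pair_mem_couplings Z₀ Z₁, hcost⟩, ?_⟩
    rintro _ ⟨γ, hγ, rfl⟩
    exact (key γ hγ).1
  refine Set.eq_singleton_iff_unique_mem.2 ⟨⟨map_pair_mem_couplings Z₀ Z₁, hcost.trans hW.symm⟩, ?_⟩
  rintro γ ⟨hγ, hγ'⟩
  rw [hpair]
  exact (key γ hγ).2 (hγ'.trans hW).le

end Matching

section Lines

variable {X : Type*} [NormedAddCommGroup X] [NormedSpace ℝ X]

/-- Two distinct uniformly moving points meet at most once. -/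
lemma finite_collision_times {R : Set (X × X)} (hR : R.Finite) :
    {t : ℝ | ∃ p ∈ R, ∃ q ∈ R, p ≠ q ∧ p.1 + t • p.2 = q.1 + t • q.2}.Finite := by
  have : {t : ℝ | ∃ p ∈ R, ∃ q ∈ R, p ≠ q ∧ p.1 + t • p.2 = q.1 + t • q.2}
      ⊆ ⋃ p ∈ R, ⋃ q ∈ R, {t : ℝ | p ≠ q ∧ p.1 + t • p.2 = q.1 + t • q.2} := by
    rintro t ⟨p, hp, q, hq, h⟩
    simp only [Set.mem_iUnion]
    exact ⟨p, hp, q, hq, h⟩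
  refine (hR.biUnion fun p _ => hR.biUnion fun q _ => ?_).subset this
  refine Set.Subsingleton.finite fun s hs t ht => ?_
  by_contra hst
  have h1 : (s - t) • (p.2 - q.2) = 0 := by
    have e : (s - t) • (p.2 - q.2)
        = (p.1 + s • p.2 - (q.1 + s • q.2)) - (p.1 + t • p.2 - (q.1 + t • q.2)) := by
      simp only [smul_sub, sub_smul]; abel
    rw [e, hs.2, ht.2, sub_self, sub_self, sub_self]
  have h2 : p.2 = q.2 := sub_eq_zero.1 ((smul_eq_zero.1 h1).resolve_left (sub_ne_zero.2 hst))
  have h3 := hs.2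
  rw [h2] at h3
  exact hs.1 (Prod.ext (add_right_cancel h3) h2)

/-- Away from collisions, the position of a moving point at time `τ.1` is strictly nearer to its
own position at time `τ.2` than to that of any other point. -/
lemma eventually_nearest {R : Set (X × X)} (hR : R.Finite) {t₀ : ℝ}
    (ht₀ : ∀ p ∈ R, ∀ q ∈ R, p.1 + t₀ • p.2 = q.1 + t₀ • q.2 → p = q) :
    ∀ᶠ τ : ℝ × ℝ in 𝓝 (t₀, t₀), ∀ p ∈ R, ∀ q ∈ R, q = p ∨
      ‖p.1 + τ.1 • p.2 - (p.1 + τ.2 • p.2)‖ < ‖p.1 + τ.1 • p.2 - (q.1 + τ.2 • q.2)‖ := by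
  refine (eventually_all_finite hR).2 fun p hp => (eventually_all_finite hR).2 fun q hq => ?_
  by_cases hpq : q = p
  · exact Eventually.of_forall fun _ => Or.inl hpq
  have h0 : ‖p.1 + t₀ • p.2 - (p.1 + t₀ • p.2)‖ < ‖p.1 + t₀ • p.2 - (q.1 + t₀ • q.2)‖ := by
    rw [sub_self, norm_zero, norm_pos_iff, sub_ne_zero]
    exact fun h => hpq (ht₀ p hp q hq h).symm
  have hopen : IsOpen {τ : ℝ × ℝ | ‖p.1 + τ.1 • p.2 - (p.1 + τ.2 • p.2)‖
      < ‖p.1 + τ.1 • p.2 - (q.1 + τ.2 • q.2)‖} :=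
    isOpen_lt (by fun_prop) (by fun_prop)
  filter_upwards [hopen.mem_nhds h0] with τ hτ using Or.inr hτ

end Lines

section SimpleLines

variable {X : Type*} [NormedAddCommGroup X] [NormedSpace ℝ X] [MeasurableSpace X] [BorelSpace X]
  [SecondCountableTopology X]
variable {Ω : Type*} [MeasurableSpace Ω] {P : Measure Ω} [IsProbabilityMeasure P]

/-- Along a line of simple random variables, nearby positions are uniquely matched, up to a finite
set of times. -/
theorem exists_finite_eventually_isUniquelyMatched {Z D : Lp X 2 P} {x d : SimpleFunc Ω X}
    (hx : Z =ᵐ[P] x) (hd : D =ᵐ[P] d) :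
    ∃ S : Set ℝ, S.Finite ∧ ∀ t₀ ∉ S, ∀ᶠ τ : ℝ × ℝ in 𝓝 (t₀, t₀),
      IsUniquelyMatched (Z + τ.1 • D) (Z + τ.2 • D) := by
  have hR : (Set.range fun ω => (x ω, d ω)).Finite :=
    (x.finite_range.prod d.finite_range).subset (by
      rintro _ ⟨ω, rfl⟩; exact ⟨⟨ω, rfl⟩, ⟨ω, rfl⟩⟩)
  refine ⟨_, finite_collision_times hR, fun t₀ ht₀ => ?_⟩
  have hsep : ∀ p ∈ Set.range (fun ω => (x ω, d ω)), ∀ q ∈ Set.range (fun ω => (x ω, d ω)),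
      p.1 + t₀ • p.2 = q.1 + t₀ • q.2 → p = q := by
    intro p hp q hq h
    by_contra hne
    exact ht₀ ⟨p, hp, q, hq, hne, h⟩
  have hrep : ∀ t : ℝ, (Z + t • D : Lp X 2 P) =ᵐ[P] fun ω => x ω + t • d ω := by
    intro t
    filter_upwards [Lp.coeFn_add Z (t • D), Lp.coeFn_smul t D, hx, hd] with ω e1 e2 e3 e4
    rw [e1, Pi.add_apply, e2, Pi.smul_apply, e3, e4]
  have hmeas : ∀ t : ℝ, Measurable fun ω => x ω + t • d ω := fun t =>
    x.measurable.add (d.measurable.const_smul t)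
  have hfin : ∀ t : ℝ, (Set.range fun ω => x ω + t • d ω).Finite := fun t =>
    (hR.image fun p => p.1 + t • p.2).subset (by
      rintro _ ⟨ω, rfl⟩; exact ⟨_, ⟨ω, rfl⟩, rfl⟩)
  filter_upwards [eventually_nearest hR hsep] with τ hτ
  refine isUniquelyMatched_of_nearest (hmeas τ.1) (hmeas τ.2) (hfin _) (hfin _) (fun ω ω' => ?_)
    (hrep _) (hrep _)
  rcases hτ _ ⟨ω, rfl⟩ _ ⟨ω', rfl⟩ with h | h
  · rw [Prod.mk.injEq] at h
    exact Or.inl (by rw [h.1, h.2])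
  · exact Or.inr h

end SimpleLines

/-! ### The metric conditions along uniquely matched pairs -/

section Matched

variable {X : Type*} [NormedAddCommGroup X] [MeasurableSpace X] [BorelSpace X]
  [SecondCountableTopology X]
variable {Ω : Type*} [MeasurableSpace Ω] {P : Measure Ω}

namespace VelocityField

lemma ae_graph (b : VelocityField X) (μ : P2 X) :
    ∀ᵐ p ∂(b.graph μ).toMeasure, p.2 = b.toFun μ p.1 :=
  (ae_map_iff (b.measurable_id_prodMk μ).aemeasurable
    (measurableSet_eq_fun measurable_snd ((b.measurable μ).comp measurable_fst))).2
    (Eventually.of_forall fun _ => rfl)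

variable [InnerProductSpace ℝ X] [IsProbabilityMeasure P]

lemma integral_velocity_map_pair (b : VelocityField X) (Z₀ Z₁ : Lp X 2 P) :
    ∫ p, ‖b.toFun (law Z₁) p.2 - b.toFun (law Z₀) p.1‖ ^ 2 ∂(P.map fun ω => (Z₀ ω, Z₁ ω))
      = ‖b.act Z₁ - b.act Z₀‖ ^ 2 := by
  have h₀ := b.measurable (law Z₀)
  have h₁ := b.measurable (law Z₁)
  rw [integral_map ((measurable_coeFn Z₀).prodMk (measurable_coeFn Z₁)).aemeasurable
    (by fun_prop), L2_norm_sq]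
  refine integral_congr_ae ?_
  filter_upwards [Lp.coeFn_sub (b.act Z₁) (b.act Z₀), b.coeFn_act Z₀, b.coeFn_act Z₁]
    with ω e e₀ e₁
  rw [e, Pi.sub_apply, e₀, e₁]

/-- The only lift of a unique optimal coupling to the graphs of `b` is the joint law of positions
and velocities, so the infimum in the pairing is a scalar product in `L²`. -/
lemma pairing_graph_law (b : VelocityField X) {Z₀ Z₁ : Lp X 2 P} (h : IsUniquelyMatched Z₀ Z₁) :
    pairing (b.graph (law Z₀)) (b.graph (law Z₁)) = ⟪Z₀ - Z₁, b.act Z₀ - b.act Z₁⟫ := by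
  have m₀ := measurable_coeFn Z₀
  have m₁ := measurable_coeFn Z₁
  have n₀ := measurable_coeFn (b.act Z₀)
  have n₁ := measurable_coeFn (b.act Z₁)
  have hb₀ := b.measurable (law Z₀)
  have hb₁ := b.measurable (law Z₁)
  have hmem : P.map (fun ω => ((Z₀ ω, b.act Z₀ ω), (Z₁ ω, b.act Z₁ ω)))
      ∈ optimalLifts (b.graph (law Z₀)) (b.graph (law Z₁)) := by
    have hm := (m₀.prodMk n₀).prodMk (m₁.prodMk n₁)
    refine ⟨⟨?_, ?_⟩, ?_⟩
    · rw [Measure.map_map measurable_fst hm, b.graph_law]; rfl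
    · rw [Measure.map_map measurable_snd hm, b.graph_law]; rfl
    · rw [base_graph, base_graph, h, Set.mem_singleton_iff, Measure.map_map (by fun_prop) hm]; rfl
  have hval : ∀ Θ ∈ optimalLifts (b.graph (law Z₀)) (b.graph (law Z₁)),
      ∫ q, ⟪q.1.1 - q.2.1, q.1.2 - q.2.2⟫ ∂Θ = ⟪Z₀ - Z₁, b.act Z₀ - b.act Z₁⟫ := by
    rintro Θ ⟨⟨hΘ₀, hΘ₁⟩, hΘ⟩
    rw [base_graph, base_graph, h, Set.mem_singleton_iff] at hΘ
    have e₀ : ∀ᵐ q ∂Θ, q.1.2 = b.toFun (law Z₀) q.1.1 :=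
      ae_of_ae_map measurable_fst.aemeasurable (hΘ₀ ▸ b.ae_graph (law Z₀))
    have e₁ : ∀ᵐ q ∂Θ, q.2.2 = b.toFun (law Z₁) q.2.1 :=
      ae_of_ae_map measurable_snd.aemeasurable (hΘ₁ ▸ b.ae_graph (law Z₁))
    calc ∫ q, ⟪q.1.1 - q.2.1, q.1.2 - q.2.2⟫ ∂Θ
        = ∫ q, ⟪q.1.1 - q.2.1, b.toFun (law Z₀) q.1.1 - b.toFun (law Z₁) q.2.1⟫ ∂Θ := by
          refine integral_congr_ae ?_
          filter_upwards [e₀, e₁] with q h₀ h₁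
          rw [h₀, h₁]
      _ = ∫ p, ⟪p.1 - p.2, b.toFun (law Z₀) p.1 - b.toFun (law Z₁) p.2⟫
            ∂(Θ.map fun q => (q.1.1, q.2.1)) :=
          (integral_map (f := fun p : X × X =>
            ⟪p.1 - p.2, b.toFun (law Z₀) p.1 - b.toFun (law Z₁) p.2⟫)
            (φ := fun q : (X × X) × (X × X) => (q.1.1, q.2.1))
            (Measurable.aemeasurable (by fun_prop))
            (Measurable.aestronglyMeasurable (by fun_prop))).symm
      _ = ∫ ω, ⟪Z₀ ω - Z₁ ω, b.toFun (law Z₀) (Z₀ ω) - b.toFun (law Z₁) (Z₁ ω)⟫ ∂P := by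
          rw [hΘ, integral_map (m₀.prodMk m₁).aemeasurable
            (Measurable.aestronglyMeasurable (by fun_prop))]
      _ = ⟪Z₀ - Z₁, b.act Z₀ - b.act Z₁⟫ := by
          rw [L2.inner_def]
          refine integral_congr_ae ?_
          filter_upwards [Lp.coeFn_sub Z₀ Z₁, Lp.coeFn_sub (b.act Z₀) (b.act Z₁), b.coeFn_act Z₀,
            b.coeFn_act Z₁] with ω h1 h2 h3 h4
          rw [h1, h2, Pi.sub_apply, Pi.sub_apply, h3, h4]
  have himg : (fun Θ : Measure ((X × X) × (X × X)) =>
      ∫ q, ⟪q.1.1 - q.2.1, q.1.2 - q.2.2⟫ ∂Θ) ''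
        optimalLifts (b.graph (law Z₀)) (b.graph (law Z₁)) = {⟪Z₀ - Z₁, b.act Z₀ - b.act Z₁⟫} := by
    refine Set.eq_singleton_iff_unique_mem.2 ⟨⟨_, hmem, hval _ hmem⟩, ?_⟩
    rintro _ ⟨Θ, hΘ, rfl⟩
    exact hval Θ hΘ
  rw [pairing, himg, csInf_singleton]

lemma inner_act_le_of_isUniquelyMatched {lam : ℝ} {b : VelocityField X}
    (hd : IsDissipative lam (Set.range b.graph)) {Z₀ Z₁ : Lp X 2 P}
    (h : IsUniquelyMatched Z₀ Z₁) :
    ⟪Z₀ - Z₁, b.act Z₀ - b.act Z₁⟫ ≤ lam * ‖Z₀ - Z₁‖ ^ 2 := by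
  have hopt : P.map (fun ω => (Z₀ ω, Z₁ ω)) ∈ optimalCouplings (law Z₀) (law Z₁) := by
    rw [h]; rfl
  have := hd _ ⟨law Z₀, rfl⟩ _ ⟨law Z₁, rfl⟩
  rwa [pairing_graph_law b h, base_graph, base_graph, ← hopt.2, integral_cost_map_pair] at this

/-- The Lipschitz estimate along some optimal coupling of any two measures. -/
def IsOptimallyLipschitz (b : VelocityField X) (L : ℝ) : Prop :=
  ∀ μ₀ μ₁ : P2 X, ∃ γ ∈ optimalCouplings μ₀ μ₁,
    ∫ p, ‖b.toFun μ₁ p.2 - b.toFun μ₀ p.1‖ ^ 2 ∂γ ≤ L ^ 2 * ∫ p, ‖p.2 - p.1‖ ^ 2 ∂γ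

lemma norm_act_sub_le_of_isUniquelyMatched {L : ℝ} (hL : 0 ≤ L) {b : VelocityField X}
    (hb : b.IsOptimallyLipschitz L) {Z₀ Z₁ : Lp X 2 P} (h : IsUniquelyMatched Z₀ Z₁) :
    ‖b.act Z₁ - b.act Z₀‖ ≤ L * ‖Z₁ - Z₀‖ := by
  obtain ⟨γ, hγ, hle⟩ := hb (law Z₀) (law Z₁)
  rw [h, Set.mem_singleton_iff] at hγ
  simp only [norm_sub_rev (_ : X × X).2 (_ : X × X).1] at hle
  rw [hγ, integral_velocity_map_pair, integral_cost_map_pair, ← mul_pow, norm_sub_rev Z₀] at hle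
  exact (pow_le_pow_iff_left₀ (norm_nonneg _) (by positivity) two_ne_zero).1 hle

end VelocityField

end Matched

/-! ### From matched pairs to all pairs of random variables -/

section SimpleApproximation

variable {X : Type*} [NormedAddCommGroup X] {Ω : Type*} [MeasurableSpace Ω] {P : Measure Ω}

lemma exists_seq_simple (Z : Lp X 2 P) :
    ∃ Zn : ℕ → Lp X 2 P, Tendsto Zn atTop (𝓝 Z) ∧ ∀ n, ∃ x : SimpleFunc Ω X, Zn n =ᵐ[P] x := by
  obtain ⟨Zn, hmem, hlim⟩ := mem_closure_iff_seq_limit.1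
    (Lp.simpleFunc.denseRange (E := X) (μ := P) (p := 2) (by norm_num) Z)
  refine ⟨Zn, hlim, fun n => ?_⟩
  obtain ⟨f, hf⟩ := hmem n
  exact ⟨Lp.simpleFunc.toSimpleFunc f, hf ▸ (Lp.simpleFunc.toSimpleFunc_eq_toFun f).symm⟩

lemma exists_simpleFunc_sub {Z₀ Z₁ : Lp X 2 P} {x₀ x₁ : SimpleFunc Ω X} (h₀ : Z₀ =ᵐ[P] x₀)
    (h₁ : Z₁ =ᵐ[P] x₁) : (Z₁ - Z₀ : Lp X 2 P) =ᵐ[P] (x₁ - x₀ : SimpleFunc Ω X) := by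
  filter_upwards [Lp.coeFn_sub Z₁ Z₀, h₀, h₁] with ω e e₀ e₁
  rw [e, Pi.sub_apply, e₀, e₁, SimpleFunc.coe_sub, Pi.sub_apply]

end SimpleApproximation

section Global

variable {X : Type*} [NormedAddCommGroup X] [InnerProductSpace ℝ X] [CompleteSpace X]
  [MeasurableSpace X] [BorelSpace X] [SecondCountableTopology X]
variable {Ω : Type*} [MeasurableSpace Ω] {P : Measure Ω} [IsProbabilityMeasure P]

namespace VelocityField

lemma continuous_inner_act_line {b : VelocityField X}
    (hb : IsDemicontinuous (Set.range b.graph)) (Z D W : Lp X 2 P) :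
    Continuous fun t : ℝ => ⟪W, b.act (Z + t • D)⟫ := by
  have : SeqContinuous fun t : ℝ => ⟪W, b.act (Z + t • D)⟫ := fun t t₀ ht =>
    tendsto_inner_act hb (tendsto_const_nhds.add (ht.smul_const D)) W
  exact this.continuous

/-- A one-sided bound on the increments of `⟪W, b(Z, law Z)⟫`, valid along uniquely matched pairs
on a line of simple random variables, holds between the end points: collisions occur at finitely
many times only, and demicontinuity bridges them. -/
lemma inner_act_sub_le_of_locally {b : VelocityField X}
    (hb : IsDemicontinuous (Set.range b.graph)) {Z D : Lp X 2 P} {x d : SimpleFunc Ω X}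
    (hx : Z =ᵐ[P] x) (hd : D =ᵐ[P] d) (W : Lp X 2 P) (c : ℝ)
    (H : ∀ s t : ℝ, s ≤ t → IsUniquelyMatched (Z + s • D) (Z + t • D) →
      ⟪W, b.act (Z + t • D)⟫ - ⟪W, b.act (Z + s • D)⟫ ≤ c * (t - s)) :
    ⟪W, b.act (Z + D) - b.act Z⟫ ≤ c := by
  obtain ⟨S, hS, hloc⟩ := exists_finite_eventually_isUniquelyMatched hx hd
  have hanti : Antitone fun t : ℝ => ⟪W, b.act (Z + t • D)⟫ - c * t := by
    refine antitone_of_continuous_of_locally_antitone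
      ((continuous_inner_act_line hb Z D W).sub (by fun_prop)) hS fun t₀ ht₀ => ?_
    filter_upwards [hloc t₀ ht₀] with τ hτ hle
    have := H τ.1 τ.2 hle hτ
    linarith
  have := hanti zero_le_one
  simp only [one_smul, zero_smul, add_zero] at this
  rw [inner_sub_right]
  linarith

/-- Metric dissipativity of a demicontinuous field makes the induced operator on `L²(Ω; X)`
dissipative. -/
theorem inner_act_sub_le {lam : ℝ} {b : VelocityField X}
    (hb : IsDemicontinuous (Set.range b.graph)) (hd : IsDissipative lam (Set.range b.graph))
    (Z₀ Z₁ : Lp X 2 P) : ⟪Z₁ - Z₀, b.act Z₁ - b.act Z₀⟫ ≤ lam * ‖Z₁ - Z₀‖ ^ 2 := by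
  obtain ⟨Yn, hY, hYs⟩ := exists_seq_simple Z₀
  obtain ⟨Zn, hZ, hZs⟩ := exists_seq_simple Z₁
  have hlim : Tendsto (fun n => ⟪Zn n - Yn n, b.act (Zn n) - b.act (Yn n)⟫) atTop
      (𝓝 ⟪Z₁ - Z₀, b.act Z₁ - b.act Z₀⟫) := by
    simp only [inner_sub_right]
    exact (tendsto_inner_act_of_tendsto hb hZ (hZ.sub hY)).sub
      (tendsto_inner_act_of_tendsto hb hY (hZ.sub hY))
  refine le_of_tendsto_of_tendsto' hlim (((hZ.sub hY).norm.pow 2).const_mul lam) fun n => ?_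
  obtain ⟨y, hy⟩ := hYs n
  obtain ⟨z, hz⟩ := hZs n
  set D := Zn n - Yn n with hD
  have key := inner_act_sub_le_of_locally hb hy (exists_simpleFunc_sub hy hz) D (lam * ‖D‖ ^ 2)
    (fun s t hst hm => ?_)
  · rwa [hD, add_sub_cancel] at key
  · rcases hst.eq_or_lt with rfl | hlt
    · simp
    have h1 := inner_act_le_of_isUniquelyMatched hd hm
    have h2 : Yn n + s • D - (Yn n + t • D) = (s - t) • D := by rw [sub_smul]; abel
    rw [h2, real_inner_smul_left, norm_smul, mul_pow, inner_sub_right, Real.norm_eq_abs,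
      sq_abs] at h1
    have h3 : 0 < t - s := sub_pos.2 hlt
    refine le_of_mul_le_mul_left ?_ h3
    linear_combination h1

/-- The Lipschitz estimate along optimal couplings makes the induced operator on `L²(Ω; X)`
Lipschitz with the same constant. -/
theorem norm_act_sub_le {L : ℝ} (hL : 0 ≤ L) {b : VelocityField X}
    (hb : IsDemicontinuous (Set.range b.graph)) (hLip : b.IsOptimallyLipschitz L)
    (Z₀ Z₁ : Lp X 2 P) : ‖b.act Z₁ - b.act Z₀‖ ≤ L * ‖Z₁ - Z₀‖ := by
  have hweak : ∀ W : Lp X 2 P, ⟪W, b.act Z₁ - b.act Z₀⟫ ≤ ‖W‖ * (L * ‖Z₁ - Z₀‖) := by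
    intro W
    obtain ⟨Yn, hY, hYs⟩ := exists_seq_simple Z₀
    obtain ⟨Zn, hZ, hZs⟩ := exists_seq_simple Z₁
    have hlim : Tendsto (fun n => ⟪W, b.act (Zn n) - b.act (Yn n)⟫) atTop
        (𝓝 ⟪W, b.act Z₁ - b.act Z₀⟫) := by
      simp only [inner_sub_right]
      exact (tendsto_inner_act hb hZ W).sub (tendsto_inner_act hb hY W)
    refine le_of_tendsto_of_tendsto' hlim (((hZ.sub hY).norm.const_mul L).const_mul ‖W‖)
      fun n => ?_
    obtain ⟨y, hy⟩ := hYs n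
    obtain ⟨z, hz⟩ := hZs n
    set D := Zn n - Yn n with hD
    have key := inner_act_sub_le_of_locally hb hy (exists_simpleFunc_sub hy hz) W
      (‖W‖ * (L * ‖D‖)) (fun s t hst hm => ?_)
    · rwa [hD, add_sub_cancel] at key
    · have h1 := norm_act_sub_le_of_isUniquelyMatched hL hLip hm
      have h2 : Yn n + t • D - (Yn n + s • D) = (t - s) • D := by rw [sub_smul]; abel
      rw [h2, norm_smul, Real.norm_of_nonneg (sub_nonneg.2 hst)] at h1
      rw [← inner_sub_right]
      refine (real_inner_le_norm _ _).trans ?_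
      refine (mul_le_mul_of_nonneg_left h1 (norm_nonneg W)).trans (le_of_eq (by ring))
  have h := hweak (b.act Z₁ - b.act Z₀)
  rw [real_inner_self_eq_norm_mul_norm] at h
  rcases (norm_nonneg (b.act Z₁ - b.act Z₀)).eq_or_lt with h0 | h0
  · rw [← h0]; positivity
  · exact le_of_mul_le_mul_left h h0

end VelocityField

end Global

/-! ### Back to probability vector fields -/

section Eulerian

variable {X : Type*} [NormedAddCommGroup X] [MeasurableSpace X] [BorelSpace X]
  [SecondCountableTopology X]
variable {Ω : Type*} [MeasurableSpace Ω] {P : Measure Ω} [IsProbabilityMeasure P]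

/-- A random variable with a given law in `𝒫₂(X)`, as an element of `L²`. -/
lemma exists_law_eq {q : Ω → X} (hq : Measurable q) {μ : P2 X} (h : P.map q = μ.toMeasure) :
    ∃ Z : Lp X 2 P, Z =ᵐ[P] q ∧ law Z = μ := by
  have hm : MemLp q 2 P := by
    have := μ.memLp_id
    rw [← h] at this
    exact (memLp_map_measure_iff measurable_id.aestronglyMeasurable hq.aemeasurable).1 this
  exact ⟨hm.toLp q, hm.coeFn_toLp, P2.ext ((Measure.map_congr hm.coeFn_toLp).trans h)⟩

namespace VelocityField

lemma exists_law_eq_act_eq (b : VelocityField X) {q : Ω → X × X} (hq : Measurable q) {μ : P2 X}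
    (h : P.map q = (b.graph μ).toMeasure) :
    ∃ Z : Lp X 2 P, (Z =ᵐ[P] fun ω => (q ω).1) ∧ (b.act Z =ᵐ[P] fun ω => (q ω).2) := by
  have hbase : P.map (fun ω => (q ω).1) = μ.toMeasure := by
    have := congrArg P2.toMeasure (b.base_graph μ)
    rw [← this]
    change _ = (b.graph μ).toMeasure.map Prod.fst
    rw [← h, Measure.map_map measurable_fst hq]; rfl
  obtain ⟨Z, hZ, hlaw⟩ := exists_law_eq hq.fst hbase
  refine ⟨Z, hZ, ?_⟩
  have hae : ∀ᵐ ω ∂P, (q ω).2 = b.toFun μ (q ω).1 :=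
    ae_of_ae_map hq.aemeasurable (h ▸ b.ae_graph μ)
  filter_upwards [b.coeFn_act Z, hZ, hae] with ω e₁ e₂ e₃
  rw [e₁, hlaw, e₂, e₃]

variable [InnerProductSpace ℝ X] [CompleteSpace X]

theorem isTotallyDissipative {lam : ℝ} {b : VelocityField X}
    (hb : IsDemicontinuous (Set.range b.graph)) (hd : IsDissipative lam (Set.range b.graph)) :
    IsTotallyDissipative lam (Set.range b.graph) := by
  rintro _ ⟨μ₀, rfl⟩ _ ⟨μ₁, rfl⟩ Θ ⟨h₀, h₁⟩
  have : IsProbabilityMeasure Θ := by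
    have hp : IsProbabilityMeasure (Θ.map Prod.fst) := h₀ ▸ (b.graph μ₀).isProb
    exact (Measure.isProbabilityMeasure_map_iff measurable_fst.aemeasurable).1 hp
  obtain ⟨Z₀, hZ₀, hV₀⟩ := b.exists_law_eq_act_eq measurable_fst h₀
  obtain ⟨Z₁, hZ₁, hV₁⟩ := b.exists_law_eq_act_eq measurable_snd h₁
  have key := inner_act_sub_le hb hd Z₀ Z₁
  rw [L2.inner_def, L2_norm_sq] at key
  refine le_trans (le_of_eq ?_) (key.trans (le_of_eq ?_))
  · refine integral_congr_ae ?_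
    filter_upwards [Lp.coeFn_sub Z₁ Z₀, Lp.coeFn_sub (b.act Z₁) (b.act Z₀), hZ₀, hZ₁, hV₀, hV₁]
      with q e e' e₁ e₂ e₃ e₄
    rw [e, e', Pi.sub_apply, Pi.sub_apply, e₁, e₂, e₃, e₄, real_inner_comm]
  · congr 1
    refine integral_congr_ae ?_
    filter_upwards [Lp.coeFn_sub Z₁ Z₀, hZ₀, hZ₁] with q e e₁ e₂
    rw [e, Pi.sub_apply, e₁, e₂]

/-- Minty's argument: testing a totally dissipative extension against the perturbations
`Z + t W` of the position and letting `t → 0` forces the velocity to be `b(Z, law Z)`. -/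
theorem eq_range_graph_of_isTotallyDissipative {lam : ℝ} {b : VelocityField X}
    (hb : IsDemicontinuous (Set.range b.graph)) {F' : Set (P2 (X × X))}
    (hsub : Set.range b.graph ⊆ F') (hF' : IsTotallyDissipative lam F') :
    F' = Set.range b.graph := by
  refine Set.Subset.antisymm (fun Φ hΦ => ?_) hsub
  obtain ⟨Z, hZ, -⟩ := exists_law_eq (P := Φ.toMeasure) (μ := Φ.base) measurable_fst rfl
  have hVm : MemLp (fun p : X × X => p.2) 2 Φ.toMeasure :=
    (memLp_two_iff_integrable_sq_norm measurable_snd.aestronglyMeasurable).2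
      Φ.integrable_norm_snd_sq
  set V : Lp X 2 Φ.toMeasure := hVm.toLp _ with hVdef
  have hV : V =ᵐ[Φ.toMeasure] fun p => p.2 := hVm.coeFn_toLp
  have hstep : ∀ (W : Lp X 2 Φ.toMeasure) (t : ℝ), 0 < t →
      ⟪W, b.act (Z + t • W)⟫ - ⟪W, V⟫ ≤ lam * t * ‖W‖ ^ 2 := by
    intro W t ht
    set Y := Z + t • W with hY
    have hm : Measurable fun p : X × X => (p, (Y p, b.act Y p)) :=
      measurable_id.prodMk ((measurable_coeFn Y).prodMk (measurable_coeFn (b.act Y)))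
    have hΘ : Φ.toMeasure.map (fun p => (p, (Y p, b.act Y p)))
        ∈ couplings Φ.toMeasure (b.graph (law Y)).toMeasure := by
      refine ⟨?_, ?_⟩
      · rw [Measure.map_map measurable_fst hm]; exact Measure.map_id
      · rw [Measure.map_map measurable_snd hm, b.graph_law]; rfl
    have h1 := hF' Φ hΦ _ (hsub ⟨law Y, rfl⟩) _ hΘ
    rw [integral_map hm.aemeasurable (Measurable.aestronglyMeasurable (by fun_prop)),
      integral_map hm.aemeasurable (Measurable.aestronglyMeasurable (by fun_prop))] at h1
    have hYZ : Y - Z = t • W := by rw [hY, add_sub_cancel_left]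
    have e1 : ∫ p, ⟪b.act Y p - p.2, Y p - p.1⟫ ∂Φ.toMeasure = ⟪b.act Y - V, t • W⟫ := by
      rw [← hYZ, L2.inner_def]
      refine integral_congr_ae ?_
      filter_upwards [Lp.coeFn_sub Y Z, Lp.coeFn_sub (b.act Y) V, hZ, hV] with p a1 a2 a3 a4
      rw [a1, a2, Pi.sub_apply, Pi.sub_apply, a3, a4]
    have e2 : ∫ p, ‖Y p - p.1‖ ^ 2 ∂Φ.toMeasure = ‖t • W‖ ^ 2 := by
      rw [← hYZ, L2_norm_sq]
      refine integral_congr_ae ?_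
      filter_upwards [Lp.coeFn_sub Y Z, hZ] with p a1 a3
      rw [a1, Pi.sub_apply, a3]
    dsimp only at h1
    rw [e1, e2, real_inner_smul_right, norm_smul, mul_pow, Real.norm_eq_abs, sq_abs,
      real_inner_comm, inner_sub_right] at h1
    refine le_of_mul_le_mul_left ?_ ht
    linear_combination h1
  have hlim : ∀ W : Lp X 2 Φ.toMeasure, ⟪W, b.act Z - V⟫ ≤ 0 := by
    intro W
    -- weak continuity along the line `Z + t W` as `t` decreases to `0`
    have hc := (continuous_inner_act_line hb Z W W).tendsto 0
    simp only [zero_smul, add_zero] at hc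
    have hl : Tendsto (fun t : ℝ => ⟪W, b.act (Z + t • W)⟫ - ⟪W, V⟫) (𝓝[>] 0)
        (𝓝 (⟪W, b.act Z⟫ - ⟪W, V⟫)) := (hc.sub_const _).mono_left nhdsWithin_le_nhds
    have hr : Tendsto (fun t : ℝ => lam * t * ‖W‖ ^ 2) (𝓝[>] 0) (𝓝 0) := by
      have : Continuous fun t : ℝ => lam * t * ‖W‖ ^ 2 := by fun_prop
      simpa using (this.tendsto 0).mono_left (nhdsWithin_le_nhds (s := Set.Ioi 0))
    rw [inner_sub_right]
    exact le_of_tendsto_of_tendsto hl hr (by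
      filter_upwards [self_mem_nhdsWithin] with t ht using hstep W t ht)
  have hact : b.act Z = V := by
    have := hlim (b.act Z - V)
    rw [real_inner_self_nonpos, sub_eq_zero] at this
    exact this
  refine ⟨law Z, P2.ext ?_⟩
  rw [b.graph_law, hact]
  refine Eq.trans (Measure.map_congr ?_) Measure.map_id
  filter_upwards [hZ, hV] with p h1 h2
  rw [h1, h2]; rfl

theorem integral_velocity_sub_le {L : ℝ} (hL : 0 ≤ L) {b : VelocityField X}
    (hb : IsDemicontinuous (Set.range b.graph)) (hLip : b.IsOptimallyLipschitz L)
    (μ₀ μ₁ : P2 X) {γ : Measure (X × X)} (hγ : γ ∈ couplings μ₀.toMeasure μ₁.toMeasure) :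
    ∫ p, ‖b.toFun μ₁ p.2 - b.toFun μ₀ p.1‖ ^ 2 ∂γ ≤ L ^ 2 * ∫ p, ‖p.2 - p.1‖ ^ 2 ∂γ := by
  have : IsProbabilityMeasure γ := by
    have hp : IsProbabilityMeasure (γ.map Prod.fst) := hγ.1 ▸ μ₀.isProb
    exact (Measure.isProbabilityMeasure_map_iff measurable_fst.aemeasurable).1 hp
  obtain ⟨Z₀, hZ₀, rfl⟩ := exists_law_eq measurable_fst hγ.1
  obtain ⟨Z₁, hZ₁, rfl⟩ := exists_law_eq measurable_snd hγ.2
  have hpair : γ.map (fun p => (Z₀ p, Z₁ p)) = γ := by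
    refine Eq.trans (Measure.map_congr ?_) Measure.map_id
    filter_upwards [hZ₀, hZ₁] with p h1 h2
    rw [h1, h2]; rfl
  have e1 := b.integral_velocity_map_pair Z₀ Z₁
  have e3 : ∫ p, ‖p.2 - p.1‖ ^ 2 ∂γ = ‖Z₁ - Z₀‖ ^ 2 := by
    rw [L2_norm_sq]
    refine integral_congr_ae ?_
    filter_upwards [Lp.coeFn_sub Z₁ Z₀, hZ₀, hZ₁] with p h h1 h2
    rw [h, Pi.sub_apply, h1, h2]
  rw [hpair] at e1
  rw [e1, e3, ← mul_pow]
  exact pow_le_pow_left₀ (norm_nonneg _) (norm_act_sub_le hL hb hLip Z₀ Z₁) 2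

end VelocityField

end Eulerian

/-- A deterministic field given by a map `f` on pairs `(x, μ)` with `x ∈ supp μ` is the range of the
graphs of a measurable velocity field that agrees with `f(·, μ)` almost everywhere. -/
lemma exists_velocityField {X : Type*} [NormedAddCommGroup X] [MeasurableSpace X] [BorelSpace X]
    [SecondCountableTopology X] {F : Set (P2 (X × X))} {f : SuppPairs X → X}
    (hdom : domain F = Set.univ)
    (hf : ∀ μ : P2 X, ∀ Φ ∈ fiber F μ,
      Φ.toMeasure = μ.toMeasure.map (fun x => (x, atMeasure f μ x))) :
    ∃ b : VelocityField X, F = Set.range b.graph ∧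
      ∀ μ : P2 X, atMeasure f μ =ᵐ[μ.toMeasure] b.toFun μ := by
  have hex : ∀ μ : P2 X, ∃ Φ, Φ ∈ fiber F μ := fun μ => by
    obtain ⟨Φ, hΦ, h⟩ : μ ∈ domain F := hdom ▸ Set.mem_univ μ
    exact ⟨Φ, hΦ, h⟩
  -- a non-measurable map would push `μ` forward to `0`, which is not a probability measure
  have hpair : ∀ μ : P2 X, AEMeasurable (fun x => (x, atMeasure f μ x)) μ.toMeasure := by
    intro μ
    obtain ⟨Φ, hΦ⟩ := hex μ
    by_contra hnot
    have h0 := hf μ Φ hΦ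
    rw [Measure.map_of_not_aemeasurable hnot] at h0
    exact IsProbabilityMeasure.ne_zero Φ.toMeasure h0
  have hae : ∀ μ : P2 X, AEMeasurable (atMeasure f μ) μ.toMeasure := fun μ =>
    measurable_snd.comp_aemeasurable (hpair μ)
  have hmap : ∀ μ : P2 X, ∀ Φ ∈ fiber F μ,
      Φ.toMeasure = μ.toMeasure.map fun x => (x, (hae μ).mk _ x) := by
    intro μ Φ hΦ
    rw [hf μ Φ hΦ]
    refine Measure.map_congr ?_
    filter_upwards [(hae μ).ae_eq_mk] with x hx
    rw [← hx]
  have hmem : ∀ μ : P2 X, MemLp ((hae μ).mk _) 2 μ.toMeasure := by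
    intro μ
    obtain ⟨Φ, hΦ⟩ := hex μ
    have h2 : MemLp (fun p : X × X => p.2) 2 Φ.toMeasure :=
      (memLp_two_iff_integrable_sq_norm measurable_snd.aestronglyMeasurable).2
        Φ.integrable_norm_snd_sq
    rw [hmap μ Φ hΦ] at h2
    exact (memLp_map_measure_iff measurable_snd.aestronglyMeasurable
      (measurable_id.prodMk (hae μ).measurable_mk).aemeasurable).1 h2
  let b : VelocityField X := ⟨fun μ => (hae μ).mk _, fun μ => (hae μ).measurable_mk, hmem⟩
  have hgraph : ∀ μ, ∀ Φ ∈ fiber F μ, b.graph μ = Φ := fun μ Φ hΦ =>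
    P2.ext (hmap μ Φ hΦ).symm
  refine ⟨b, Set.Subset.antisymm (fun Φ hΦ => ⟨Φ.base, hgraph _ Φ ⟨hΦ, rfl⟩⟩) ?_,
    fun μ => (hae μ).ae_eq_mk⟩
  rintro _ ⟨μ, rfl⟩
  obtain ⟨Φ, hΦ⟩ := hex μ
  rw [hgraph μ Φ hΦ]
  exact hΦ.1

lemma lipschitzAlong_iff {X : Type*} [NormedAddCommGroup X] [MeasurableSpace X]
    {f : SuppPairs X → X} {b₀ b₁ : X → X} {L : ℝ} {μ₀ μ₁ : P2 X} {γ : Measure (X × X)}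
    (hγ : γ ∈ couplings μ₀.toMeasure μ₁.toMeasure) (h₀ : atMeasure f μ₀ =ᵐ[μ₀.toMeasure] b₀)
    (h₁ : atMeasure f μ₁ =ᵐ[μ₁.toMeasure] b₁) :
    LipschitzAlong f L μ₀ μ₁ γ ↔
      ∫ p, ‖b₁ p.2 - b₀ p.1‖ ^ 2 ∂γ ≤ L ^ 2 * ∫ p, ‖p.2 - p.1‖ ^ 2 ∂γ := by
  have e₀ : ∀ᵐ p ∂γ, atMeasure f μ₀ p.1 = b₀ p.1 :=
    ae_of_ae_map measurable_fst.aemeasurable (p := fun x => atMeasure f μ₀ x = b₀ x)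
      (by rw [hγ.1]; exact h₀)
  have e₁ : ∀ᵐ p ∂γ, atMeasure f μ₁ p.2 = b₁ p.2 :=
    ae_of_ae_map measurable_snd.aemeasurable (p := fun x => atMeasure f μ₁ x = b₁ x)
      (by rw [hγ.2]; exact h₁)
  have : ∫ p, ‖atMeasure f μ₁ p.2 - atMeasure f μ₀ p.1‖ ^ 2 ∂γ
      = ∫ p, ‖b₁ p.2 - b₀ p.1‖ ^ 2 ∂γ := by
    refine integral_congr_ae ?_
    filter_upwards [e₀, e₁] with p h h'
    rw [h, h']
  rw [LipschitzAlong, this]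

end PVF

theorem mainTheorem5 {X : Type*} [NormedAddCommGroup X] [InnerProductSpace ℝ X]
    [CompleteSpace X] [SecondCountableTopology X] [MeasurableSpace X] [BorelSpace X]
    (lam : ℝ) (F : Set (PVF.P2 (X × X))) (f : PVF.SuppPairs X → X)
    (hPVF : PVF.IsPVF F)
    (hdet : PVF.IsDeterministic F)
    (hdemi : PVF.IsDemicontinuous F)
    (hdiss : PVF.IsDissipative lam F)
    (hdom : PVF.domain F = Set.univ)
    (hf : ∀ μ : PVF.P2 X, ∀ Φ ∈ PVF.fiber F μ,
      Φ.toMeasure = μ.toMeasure.map (fun x => (x, PVF.atMeasure f μ x))) :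
    PVF.IsMaximalTotallyDissipative lam F ∧
    ∀ L : ℝ, 0 < L →
      (∀ μ₀ μ₁ : PVF.P2 X, ∃ γ ∈ PVF.optimalCouplings μ₀ μ₁,
        PVF.LipschitzAlong f L μ₀ μ₁ γ) →
      ∀ μ₀ μ₁ : PVF.P2 X, ∀ γ ∈ PVF.couplings μ₀.toMeasure μ₁.toMeasure,
        PVF.LipschitzAlong f L μ₀ μ₁ γ := by
  obtain ⟨b, rfl, hae⟩ := PVF.exists_velocityField hdom hf
  refine ⟨⟨b.isTotallyDissipative hdemi hdiss,
    fun F' hsub hF' => b.eq_range_graph_of_isTotallyDissipative hdemi hsub hF'⟩, ?_⟩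
  intro L hL hopt μ₀ μ₁ γ hγ
  have hLip : b.IsOptimallyLipschitz L := by
    intro ν₀ ν₁
    obtain ⟨γ', hγ', hle⟩ := hopt ν₀ ν₁
    exact ⟨γ', hγ', (PVF.lipschitzAlong_iff hγ'.1 (hae ν₀) (hae ν₁)).1 hle⟩
  exact (PVF.lipschitzAlong_iff hγ (hae μ₀) (hae μ₁)).2
    (b.integral_velocity_sub_le hL.le hdemi hLip μ₀ μ₁ hγ)
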